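/- Let $k$ be an algebraically closed field and let $\mathfrak a$ be a finite $k$-variety, that is, a $k$-linear additive category with finite-dimensional Hom-spaces in which idempotents split. Let $\operatorname{mod}\mathfrak a$ denote the category of finitely presented right $\mathfrak a$-modules (contravariant functors $M$ from $\mathfrak a$ to $k$-vector spaces having a presentation $\mathfrak a(-,B)\to\mathfrak a(-,A)\to M\to 0$), let $\mathfrak a^\circ$ be the opposite category, and let $(-)^*=\operatorname{Hom}_k(-,k)$. Assume that $\mathfrak a$ is *semi-hereditary*, i.e. $\operatorname{mod}\mathfrak a$ is abelian and hereditary, and *dualizing*, i.e. $D(M)(x)=M(x)^*$ restricts to a duality $\operatorname{mod}\mathfrak a\to\operatorname{mod}\mathfrak a^\circ$. For a right module $M$, let $\operatorname{supp}M$ be the full replete additive subcategory of $\mathfrak a$ whose indecomposable objects are the indecomposables $Z$ with $M(Z)\neq 0$. For $X,Y$ indecomposable, let $[X,Y]$ be the full replete additive subcategory of $\mathfrak a$ whose indecomposable objects are the indecomposables $Z$ with $\mathfrak a(X,Z)\ne0$ and $\mathfrak a(Z,Y)\neq 0$. An indecomposable object $X$ is a *thread object* if it has a unique direct predecessor and a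 unique direct successor, i.e. if there are indecomposable objects $M,N$ and nonzero maps $f:X\to M$ and $g:N\to X$ such that $f$ is not a split monomorphism and every map starting in $X$ that is not a split monomorphism factors through $f$, and $g$ is not a split epimorphism and every map ending in $X$ that is not a split epimorphism factors through $g$. Other indecomposable objects are called *nonthread objects*. The subcategory $[X,Y]$ is a *thread* if all its indecomposable objects are thread objects. Let $X,Y,Z$ be indecomposable objects of $\mathfrak a$. Then: 1. $\operatorname{supp}\mathfrak a(X,-)^*$ and $\operatorname{supp}\mathfrak a(-,X)$ each contain, up to isomorphism, only finitely many nonthread objects. 2. If $[X,Y]$ is a thread and $[X,Y]\neq 0$, then $\dim_k\mathfrak a(X,Y)=1$. 3. If $[X,Y]$ and $[X,Z]$ are threads, then $[X,Y]\subseteq[X,Z]$ or $[X,Z]\subseteq[X,Y]$. -/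

import Mathlib

open CategoryTheory CategoryTheory.Limits Opposite

universe v u

noncomputable section

namespace ThreadCat

section Modules

variable (k : Type v) [Field k] (C : Type u) [Category.{v} C] [Preadditive C] [Linear k C]

/-- All Hom-spaces of the `k`-linear category `C` are finite dimensional. -/
def HomFinite : Prop := ∀ X Y : C, Module.Finite k (X ⟶ Y)

/-- Finitely presented right modules: contravariant functors `M` to vector spaces for which there
is an exact sequence `C(-,B) → C(-,A) → M → 0`. The category `C` is meant to be additive with split
idempotents, so the finitely generated projective right modules are exactly the `C(-,A)`. -/
def IsFPRight : ObjectProperty (Cᵒᵖ ⥤ ModuleCat.{v} k) := fun M =>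
  ∃ (A B : C) (f : B ⟶ A) (p : (linearYoneda k C).obj A ⟶ M), ∀ x : Cᵒᵖ,
    Function.Exact (((linearYoneda k C).map f).app x).hom (p.app x).hom ∧
      Function.Surjective (p.app x).hom

/-- Finitely presented left modules: covariant functors `N` to vector spaces for which there
is an exact sequence `C(B,-) → C(A,-) → N → 0`. -/
def IsFPLeft : ObjectProperty (C ⥤ ModuleCat.{v} k) := fun N =>
  ∃ (A B : C) (f : A ⟶ B) (p : (linearCoyoneda k C).obj (op A) ⟶ N), ∀ x : C,
    Function.Exact (((linearCoyoneda k C).map f.op).app x).hom (p.app x).hom ∧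
      Function.Surjective (p.app x).hom

/-- The category of finitely presented right `C`-modules. -/
abbrev FPRight := (IsFPRight k C).FullSubcategory

/-- The category of finitely presented left `C`-modules. -/
abbrev FPLeft := (IsFPLeft k C).FullSubcategory

/-- `C` is semi-hereditary: the category of finitely presented right modules is abelian and
hereditary, that is, `Ext` vanishes in degrees at least two. (The preadditive structure that an
abelian category carries is unique, so the quantifier makes no choice.) -/
def IsSemiHereditary : Prop :=
  ∃ _ : Abelian (FPRight k C), ∀ M : FPRight k C, HasProjectiveDimensionLE M 1

/-- The vector space dual `V ↦ V*` as a contravariant functor. -/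
def dualVect : (ModuleCat.{v} k)ᵒᵖ ⥤ ModuleCat.{v} k where
  obj V := ModuleCat.of k (Module.Dual k V.unop)
  map f := ModuleCat.ofHom f.unop.hom.dualMap

/-- The contravariant functor `D` from right to left modules, `D(M)(x) = M(x)*`. -/
def dualFunctor : (Cᵒᵖ ⥤ ModuleCat.{v} k)ᵒᵖ ⥤ (C ⥤ ModuleCat.{v} k) :=
  (Functor.leftOpRightOpEquiv C (ModuleCat.{v} k)).functor ⋙
    (Functor.whiskeringRight _ _ _).obj (dualVect k)

/-- `C` is dualizing: `D` takes finitely presented right modules to finitely presented left modules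
and the restricted functor is a duality, that is, a contravariant equivalence. -/
def IsDualizing : Prop :=
  ∃ h : ∀ M : (FPRight k C)ᵒᵖ, IsFPLeft k C (((IsFPRight k C).ι.op ⋙ dualFunctor k C).obj M),
    ((IsFPLeft k C).lift ((IsFPRight k C).ι.op ⋙ dualFunctor k C) h).IsEquivalence

variable {C}

/-- The standard projective right module `C(-,X)`. -/
def stdProjective (X : C) : Cᵒᵖ ⥤ ModuleCat.{v} k := (linearYoneda k C).obj X

/-- The standard injective right module `C(X,-)*`. -/
def stdInjective (X : C) : Cᵒᵖ ⥤ ModuleCat.{v} k :=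
  ((linearCoyoneda k C).obj (op X)).op ⋙ dualVect k

end Modules

section Threads

variable {C : Type u} [Category.{v} C] [Preadditive C] [HasBinaryBiproducts C]

/-- The full replete additive subcategory of all objects whose indecomposable direct summands all
satisfy `P`. -/
def addOf (P : C → Prop) : ObjectProperty C := fun Z =>
  ∀ W : C, Indecomposable W → Nonempty (Retract W Z) → P W

/-- The support of a right module `M`: its indecomposable objects are those `W` with
`M(W) ≠ 0`. -/
def supp {k : Type v} [Field k] (M : Cᵒᵖ ⥤ ModuleCat.{v} k) : ObjectProperty C :=
  addOf fun W => Nontrivial (M.obj (op W))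

/-- The subcategory `[X,Y]`: its indecomposable objects are those `W` with `C(X,W) ≠ 0` and
`C(W,Y) ≠ 0`. -/
def interval (X Y : C) : ObjectProperty C :=
  addOf fun W => Nontrivial (X ⟶ W) ∧ Nontrivial (W ⟶ Y)

/-- An almost split map starting at `X`: it is nonsplit, and every nonsplit map starting at `X`
factors through it. -/
def IsAlmostSplitFrom {X M : C} (f : X ⟶ M) : Prop :=
  ¬ IsSplitMono f ∧ ∀ (B : C) (g : X ⟶ B), ¬ IsSplitMono g → ∃ h : M ⟶ B, f ≫ h = g

/-- An almost split map ending at `X`: it is nonsplit, and every nonsplit map ending at `X`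
factors through it. -/
def IsAlmostSplitTo {N X : C} (f : N ⟶ X) : Prop :=
  ¬ IsSplitEpi f ∧ ∀ (B : C) (g : B ⟶ X), ¬ IsSplitEpi g → ∃ h : B ⟶ N, h ≫ f = g

/-- Thread objects: indecomposable objects `X` with a unique direct successor `M` and a unique
direct predecessor `N`. The almost split maps `X ⟶ M` and `N ⟶ X` are required to be nonzero:
otherwise an object without any direct successor (such as a sink) would qualify, through the zero
map to an arbitrary indecomposable object. Between indecomposable objects, nonzero almost split maps
are the minimal ones. -/
def IsThreadObject (X : C) : Prop :=
  Indecomposable X ∧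
    (∃ (M : C) (f : X ⟶ M), Indecomposable M ∧ f ≠ 0 ∧ IsAlmostSplitFrom f) ∧
    (∃ (N : C) (g : N ⟶ X), Indecomposable N ∧ g ≠ 0 ∧ IsAlmostSplitTo g)

/-- Nonthread objects: indecomposable objects that are not thread objects. -/
def IsNonthreadObject (X : C) : Prop := Indecomposable X ∧ ¬ IsThreadObject X

/-- `[X,Y]` is a thread: all its indecomposable objects are thread objects. -/
def IsThread (X Y : C) : Prop :=
  ∀ Z : C, Indecomposable Z → interval X Y Z → IsThreadObject Z

/-- Up to isomorphism, only finitely many objects satisfy `P`. -/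
def FinitelyManyUpToIso (P : C → Prop) : Prop :=
  ∃ S : Finset C, ∀ Z : C, P Z → ∃ W ∈ S, Nonempty (Z ≅ W)

end Threads

end ThreadCat

end

noncomputable section

namespace ThreadCat

/-! ### Direct sum decompositions by induction on the dimension of the endomorphism ring -/

section Decomposition

variable {C : Type u} [Category.{v} C] [Preadditive C]

/-! Heredity makes the image of a map between representable modules projective, so every map of `C`
is a split epimorphism followed by a monomorphism (`ImagesSplitOff`). Hence nonzero maps out of an
indecomposable are mono, nonzero maps into one are epi, and an indecomposable has endomorphism ring
`k`. Duality makes `C(X,-)*` and `C(-,X)*` finitely generated, and kernels of finitely presented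
modules show that the maps orthogonal to a linear form are all multiples of one map. For a form on
`End Z` that is nonzero at the identity, this map is almost split.

Finiteness (`finitelyManyUpToIso_nonthread`): let `d Z` be `dim C(Z,X)`. A two-term projective
resolution of `C(-,X)*` shows that almost split maps `R ⟶ Z` and `Z ⟶ L` preserve `d`, except at the
summands of a fixed object. Nonzero maps between indecomposables do not increase `d`, so every
summand of `R` has dimension at least `d Z = d R`, which leaves room for one summand only. The same
holds for `L`, since `Z` is a summand of the predecessors of each summand of `L`. For `dim C(X,-)`
the count runs in `Cᵒᵖ`.

Threads (`eq_zero_of_isThread`): if a nonzero `h : X ⟶ Y` were orthogonal to a nonzero form on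
`C(X,T)`, the universal orthogonal map out of `X` would have a summand `A` in the thread `[X,Y]`.
The unique predecessor of `A` is orthogonal as well, which contradicts universality. Taking `T = Y`
gives dimension one; taking `T = Z` with no nonzero maps between `Y` and `Z` gives comparability. -/

theorem finrank_end_lt_of_retract {k : Type v} [Field k] [Linear k C]
    (hfin : HomFinite k C) {A B : C} (i : A ⟶ B) (p : B ⟶ A)
    (h : i ≫ p = 𝟙 A) (hne : p ≫ i ≠ 𝟙 B) :
    Module.finrank k (A ⟶ A) < Module.finrank k (B ⟶ B) := by
  have := hfin A A
  have := hfin B B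
  let φ : (A ⟶ A) →ₗ[k] (B ⟶ B) := (Linear.leftComp k B p).comp (Linear.rightComp k A i)
  have hφ : ∀ f, φ f = p ≫ f ≫ i := fun f => rfl
  have hinj : Function.Injective φ := fun a b hab => by
    rw [hφ, hφ] at hab
    have := congrArg (fun t => i ≫ t ≫ p) hab
    simpa [h, reassoc_of% h] using this
  rw [← LinearMap.finrank_range_of_inj hinj]
  refine Submodule.finrank_lt fun htop => ?_
  obtain ⟨f, hf⟩ := LinearMap.range_eq_top.1 htop (𝟙 B)
  rw [hφ] at hf
  apply hne
  calc p ≫ i = (p ≫ f ≫ i) ≫ p ≫ i := by rw [hf, Category.id_comp]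
    _ = p ≫ f ≫ i := by simp [reassoc_of% h]
    _ = 𝟙 B := hf

variable [HasBinaryBiproducts C]

theorem exists_nontrivial_biprod {X : C} (h0 : ¬ IsZero X) (hX : ¬ Indecomposable X) :
    ∃ (Y Z : C) (_ : X ≅ Y ⊞ Z), ¬ IsZero Y ∧ ¬ IsZero Z := by
  by_contra hcon
  push Not at hcon
  refine hX ⟨h0, fun Y Z e => ?_⟩
  by_cases hY : IsZero Y
  · exact Or.inl hY
  · exact Or.inr (hcon Y Z e hY)

theorem fst_inl_ne_id {Y Z : C} (hZ : ¬ IsZero Z) :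
    (biprod.fst ≫ biprod.inl : Y ⊞ Z ⟶ Y ⊞ Z) ≠ 𝟙 _ := fun h => hZ <| by
  have := congrArg (fun t => biprod.inr ≫ t ≫ biprod.snd) h
  rw [IsZero.iff_id_eq_zero]
  simpa using this.symm

theorem snd_inr_ne_id {Y Z : C} (hY : ¬ IsZero Y) :
    (biprod.snd ≫ biprod.inr : Y ⊞ Z ⟶ Y ⊞ Z) ≠ 𝟙 _ := fun h => hY <| by
  have := congrArg (fun t => biprod.inl ≫ t ≫ biprod.fst) h
  rw [IsZero.iff_id_eq_zero]
  simpa using this.symm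

variable {k : Type v} [Field k] [Linear k C]

/-- Induction over direct sum decompositions. -/
theorem biprod_induction (hfin : HomFinite k C) {P : C → Prop}
    (zero : ∀ X, IsZero X → P X) (indec : ∀ X, Indecomposable X → P X)
    (sum : ∀ X Y Z : C, (X ≅ Y ⊞ Z) → P Y → P Z → P X) (X : C) : P X := by
  by_cases h0 : IsZero X
  · exact zero X h0
  by_cases hX : Indecomposable X
  · exact indec X hX
  obtain ⟨Y, Z, e, hY, hZ⟩ := exists_nontrivial_biprod h0 hX
  have h1 : Module.finrank k (Y ⟶ Y) < Module.finrank k (X ⟶ X) := by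
    refine finrank_end_lt_of_retract hfin (biprod.inl ≫ e.inv) (e.hom ≫ biprod.fst) (by simp)
      fun h => fst_inl_ne_id (Y := Y) hZ ?_
    rw [← cancel_epi e.hom, ← cancel_mono e.inv]
    simpa using h
  have h2 : Module.finrank k (Z ⟶ Z) < Module.finrank k (X ⟶ X) := by
    refine finrank_end_lt_of_retract hfin (biprod.inr ≫ e.inv) (e.hom ≫ biprod.snd) (by simp)
      fun h => snd_inr_ne_id (Z := Z) hY ?_
    rw [← cancel_epi e.hom, ← cancel_mono e.inv]
    simpa using h
  exact sum X Y Z e (biprod_induction hfin zero indec sum Y)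
    (biprod_induction hfin zero indec sum Z)
termination_by Module.finrank k (X ⟶ X)

theorem exists_indecomposable_retract_comp_ne_zero (hfin : HomFinite k C) {B Y : C} {t : B ⟶ Y}
    (ht : t ≠ 0) : ∃ (A : C) (i : A ⟶ B) (p : B ⟶ A),
      Indecomposable A ∧ i ≫ p = 𝟙 A ∧ i ≫ t ≠ 0 := by
  refine biprod_induction hfin (P := fun B => ∀ t : B ⟶ Y, t ≠ 0 → ∃ (A : C) (i : A ⟶ B)
    (p : B ⟶ A), Indecomposable A ∧ i ≫ p = 𝟙 A ∧ i ≫ t ≠ 0) ?_ ?_ ?_ B t ht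
  · exact fun X hX t ht => absurd (hX.eq_of_src t 0) ht
  · exact fun X hX t ht => ⟨X, 𝟙 X, 𝟙 X, hX, by simp, by simpa⟩
  · intro X Y' Z e hY hZ t ht
    by_cases h1 : biprod.inl ≫ e.inv ≫ t = 0
    · have h2 : biprod.inr ≫ e.inv ≫ t ≠ 0 := fun h2 => ht <| by
        rw [← cancel_epi e.inv]
        ext <;> simp [h1, h2]
      obtain ⟨A, i, p, hA, hip, hit⟩ := hZ _ h2
      exact ⟨A, i ≫ biprod.inr ≫ e.inv, e.hom ≫ biprod.snd ≫ p, hA, by simp [hip], by simpa⟩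
    · obtain ⟨A, i, p, hA, hip, hit⟩ := hY _ h1
      exact ⟨A, i ≫ biprod.inl ≫ e.inv, e.hom ≫ biprod.fst ≫ p, hA, by simp [hip], by simpa⟩

theorem exists_indecomposable_retract (hfin : HomFinite k C) {X : C} (hX : ¬ IsZero X) :
    ∃ A : C, Indecomposable A ∧ Nonempty (Retract A X) := by
  obtain ⟨A, i, p, hA, hip, -⟩ := exists_indecomposable_retract_comp_ne_zero (t := 𝟙 X) hfin
    (fun h => hX ((IsZero.iff_id_eq_zero X).2 h))
  exact ⟨A, hA, ⟨⟨i, p, hip⟩⟩⟩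

end Decomposition

/-! ### Split images, and maps between indecomposable objects -/

section Retracts

variable {C : Type u} [Category.{v} C] [Preadditive C] [HasBinaryBiproducts C]
  [IsIdempotentComplete C]

theorem exists_iso_biprod_of_retract {X Y : C} (i : X ⟶ Y) (p : Y ⟶ X) (h : i ≫ p = 𝟙 X) :
    ∃ (X' : C) (e : Y ≅ X ⊞ X'), e.hom ≫ biprod.fst = p ∧ biprod.inl ≫ e.inv = i := by
  obtain ⟨X', j, q, hjq, hqj⟩ := IsIdempotentComplete.idempotents_split Y (𝟙 Y - p ≫ i)
    (by simp [Preadditive.sub_comp, Preadditive.comp_sub, reassoc_of% h])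
  have hj : j ≫ p = 0 := by
    have h1 : j ≫ p = j ≫ (q ≫ j) ≫ p := by simp [reassoc_of% hjq]
    rw [h1, hqj]
    simp [Preadditive.sub_comp, h]
  have hq : i ≫ q = 0 := by
    have h1 : i ≫ q = i ≫ (q ≫ j) ≫ q := by simp [hjq]
    rw [h1, hqj]
    simp [Preadditive.sub_comp, reassoc_of% h]
  refine ⟨X', ⟨biprod.lift p q, biprod.desc i j, ?_, ?_⟩, by simp, by simp⟩
  · simp [hqj]
  · ext <;> simp [h, hj, hq, hjq]

theorem isIso_of_isSplitEpi_of_indecomposable {A B : C} (hA : Indecomposable A) (hB : ¬ IsZero B)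
    (p : A ⟶ B) [IsSplitEpi p] : IsIso p := by
  obtain ⟨X', e, he, hi⟩ := exists_iso_biprod_of_retract (section_ p) p (by simp)
  have hX' : IsZero X' := (hA.2 _ _ e).resolve_left hB
  refine ⟨section_ p, ?_, by simp⟩
  have h0 : (biprod.snd : B ⊞ X' ⟶ X') = 0 := hX'.eq_of_tgt _ _
  have h1 := biprod.total (X := B) (Y := X')
  rw [h0, zero_comp, add_zero] at h1
  calc p ≫ section_ p = e.hom ≫ (biprod.fst ≫ biprod.inl) ≫ e.inv := by
        simp [reassoc_of% he, hi]
    _ = 𝟙 A := by simp [h1]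

theorem isIso_of_isSplitMono_of_indecomposable {A B : C} (hB : Indecomposable B) (hA : ¬ IsZero A)
    (i : A ⟶ B) [IsSplitMono i] : IsIso i := by
  have := isIso_of_isSplitEpi_of_indecomposable hB hA (retraction i)
  have h : i = inv (retraction i) := by
    rw [← cancel_mono (retraction i)]; simp
  rw [h]; infer_instance

/-- Every morphism is a split epimorphism followed by a monomorphism: the morphisms between
projective modules have projective images. -/
def ImagesSplitOff (C : Type u) [Category.{v} C] : Prop :=
  ∀ ⦃A B : C⦄ (f : A ⟶ B), ∃ (A' : C) (p : A ⟶ A') (i : A' ⟶ B),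
    IsSplitEpi p ∧ Mono i ∧ p ≫ i = f

namespace ImagesSplitOff

theorem mono_of_ne_zero (H : ImagesSplitOff C) {A B : C} (hA : Indecomposable A)
    {f : A ⟶ B} (hf : f ≠ 0) : Mono f := by
  obtain ⟨A', p, i, hp, hi, rfl⟩ := H f
  have hA' : ¬ IsZero A' := fun h => hf (by rw [h.eq_of_tgt p 0, zero_comp])
  have := isIso_of_isSplitEpi_of_indecomposable hA hA' p
  exact mono_comp p i

/-- A nonzero map out of `B` is mono, so it cannot kill `f`. -/
theorem epi_of_ne_zero (H : ImagesSplitOff C) {A B : C} (hB : Indecomposable B)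
    {f : A ⟶ B} (hf : f ≠ 0) : Epi f := by
  refine Preadditive.epi_of_cancel_zero f fun {T} h hh => ?_
  by_contra h0
  have := H.mono_of_ne_zero hB h0
  exact hf (by rw [← cancel_mono h, hh, zero_comp])

theorem comp_ne_zero (H : ImagesSplitOff C) {A B D : C} (hB : Indecomposable B)
    {f : A ⟶ B} {g : B ⟶ D} (hf : f ≠ 0) (hg : g ≠ 0) : f ≫ g ≠ 0 := by
  have := H.mono_of_ne_zero hB hg
  intro h
  exact hf (by rw [← cancel_mono g, h, zero_comp])

end ImagesSplitOff

section Finite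

variable {k : Type v} [Field k] [Linear k C]

/-- `f` is mono, so composing with it is an injective, hence bijective, linear map on the
finite-dimensional space `End X`. -/
theorem isIso_of_endo_ne_zero (hfin : HomFinite k C) (H : ImagesSplitOff C) {X : C}
    (hX : Indecomposable X) {f : X ⟶ X} (hf : f ≠ 0) : IsIso f := by
  have := H.mono_of_ne_zero hX hf
  have := hfin X X
  have hinj : Function.Injective (Linear.rightComp k X f) := fun a b hab => by
    simpa [cancel_mono] using hab
  obtain ⟨s, hs⟩ := LinearMap.surjective_of_injective hinj (𝟙 X)
  have : IsSplitEpi f := ⟨⟨⟨s, hs⟩⟩⟩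
  exact isIso_of_mono_of_isSplitEpi f

theorem exists_smul_id_eq [IsAlgClosed k] (hfin : HomFinite k C) (H : ImagesSplitOff C) {X : C}
    (hX : Indecomposable X) (f : X ⟶ X) : ∃ c : k, c • 𝟙 X = f := by
  have := hfin X X
  have h0 : 𝟙 X ≠ 0 := fun h => hX.1 ((IsZero.iff_id_eq_zero X).2 h)
  have h1 : Module.finrank k (X ⟶ X) = 1 := by
    refine finrank_endomorphism_eq_one k fun f => ⟨fun hf h => ?_, isIso_of_endo_ne_zero hfin H hX⟩
    subst h
    exact h0 (by rw [← IsIso.hom_inv_id (0 : X ⟶ X), zero_comp])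
  exact (finrank_eq_one_iff_of_nonzero' (𝟙 X) h0).1 h1 f

/-- Krull–Schmidt in the form needed: for a summand `A` of `Y ⊞ Z`, the identity of `A` is the sum
of a map through `Y` and one through `Z`. Nonzero endomorphisms of `A` are invertible, so `A` is a
summand of `Y` or of `Z`. -/
theorem finitelyManyUpToIso_retract (hfin : HomFinite k C) (H : ImagesSplitOff C) (E : C) :
    FinitelyManyUpToIso fun A : C => Indecomposable A ∧ Nonempty (Retract A E) := by
  classical
  refine biprod_induction hfin (P := fun E => FinitelyManyUpToIso fun A : C =>
    Indecomposable A ∧ Nonempty (Retract A E)) ?_ ?_ ?_ E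
  · rintro E hE
    refine ⟨∅, fun A ⟨hA, ⟨r⟩⟩ => (hA.1 ?_).elim⟩
    rw [IsZero.iff_id_eq_zero, ← r.retract, hE.eq_of_tgt r.i 0, zero_comp]
  · rintro E hE
    refine ⟨{E}, fun A ⟨hA, ⟨r⟩⟩ => ⟨E, by simp, ?_⟩⟩
    have := isIso_of_isSplitMono_of_indecomposable hE hA.1 r.i
    exact ⟨asIso r.i⟩
  · rintro E Y Z e ⟨S, hS⟩ ⟨T, hT⟩
    refine ⟨S ∪ T, fun A ⟨hA, ⟨r⟩⟩ => ?_⟩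
    have key : (r.i ≫ e.hom ≫ biprod.fst) ≫ (biprod.inl ≫ e.inv ≫ r.r) +
        (r.i ≫ e.hom ≫ biprod.snd) ≫ (biprod.inr ≫ e.inv ≫ r.r) = 𝟙 A := by
      have h1 : (r.i ≫ e.hom) ≫ (biprod.fst ≫ biprod.inl + biprod.snd ≫ biprod.inr) ≫
          e.inv ≫ r.r = 𝟙 A := by
        rw [biprod.total]; simp
      rw [← h1, Preadditive.add_comp, Preadditive.comp_add]
      simp only [Category.assoc]
    by_cases h1 : (r.i ≫ e.hom ≫ biprod.fst) ≫ (biprod.inl ≫ e.inv ≫ r.r) = 0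
    · rw [h1, zero_add] at key
      obtain ⟨W, hW, hAW⟩ := hT A ⟨hA, ⟨⟨_, _, key⟩⟩⟩
      exact ⟨W, by simp [hW], hAW⟩
    · have := isIso_of_endo_ne_zero hfin H hA h1
      obtain ⟨W, hW, hAW⟩ := hS A ⟨hA, ⟨⟨_, _ ≫ inv ((r.i ≫ e.hom ≫ biprod.fst) ≫
        (biprod.inl ≫ e.inv ≫ r.r)), by
          rw [← Category.assoc, IsIso.hom_inv_id]⟩⟩⟩
      exact ⟨W, by simp [hW], hAW⟩

/-- The dual of `ImagesSplitOff`. -/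
theorem ImagesSplitOff.exists_epi_splitMono (hfin : HomFinite k C)
    (H : ImagesSplitOff C) {A B : C} (f : A ⟶ B) :
    ∃ (B' : C) (p : A ⟶ B') (i : B' ⟶ B), Epi p ∧ IsSplitMono i ∧ p ≫ i = f := by
  by_cases hf : Epi f
  · exact ⟨B, f, 𝟙 B, hf, inferInstance, by simp⟩
  obtain ⟨T, h, hfh, h0⟩ : ∃ (T : C) (h : B ⟶ T), f ≫ h = 0 ∧ h ≠ 0 := by
    by_contra hcon
    push Not at hcon
    exact hf (Preadditive.epi_of_cancel_zero f fun {T} h hh => hcon T h hh)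
  -- The split image `T'` of `h` is a nonzero summand of `B` on which `f` vanishes. So `f` lands in
  -- its complement `B'`, whose endomorphism ring is smaller.
  obtain ⟨T', q, j, hq, hj, rfl⟩ := H h
  have hfq : f ≫ q = 0 := by rw [← cancel_mono j, Category.assoc, hfh, zero_comp]
  have hT' : ¬ IsZero T' := fun hz => h0 (by rw [hz.eq_of_tgt q 0, zero_comp])
  obtain ⟨B', e, he, -⟩ := exists_iso_biprod_of_retract (section_ q) q (by simp)
  have hid : (biprod.inr ≫ e.inv) ≫ e.hom ≫ biprod.snd = 𝟙 B' := by simp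
  have hlt : Module.finrank k (B' ⟶ B') < Module.finrank k (B ⟶ B) := by
    refine finrank_end_lt_of_retract hfin _ _ hid fun h => snd_inr_ne_id (Z := B') hT' ?_
    rw [← cancel_epi e.hom, ← cancel_mono e.inv]
    simpa using h
  obtain ⟨B'', p, i, hp, hi, hpi⟩ := H.exists_epi_splitMono hfin (f ≫ e.hom ≫ biprod.snd)
  have : IsSplitMono (biprod.inr ≫ e.inv : B' ⟶ B) := ⟨⟨⟨_, hid⟩⟩⟩
  refine ⟨B'', p, i ≫ biprod.inr ≫ e.inv, hp, inferInstance, ?_⟩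
  rw [reassoc_of% hpi, ← cancel_mono e.hom]
  ext <;> simp [he, hfq]
termination_by Module.finrank k (B ⟶ B)

end Finite

end Retracts

/-! ### Finiteness conditions stated through linear forms on Hom-spaces -/

section Forms

variable (k : Type v) [Field k] (C : Type u) [Category.{v} C] [Preadditive C] [Linear k C]

/-- For every linear form `φ` on `C(W,Y)`, the left module of all `h : W ⟶ Z` that are orthogonal
to `C(Z,Y)` with respect to `φ` is generated by one element. It is the kernel of the morphism
`C(W,-) ⟶ C(-,Y)*` given by `φ`. -/
def LeftAnnihilatorsFG : Prop :=
  ∀ (W Y : C) (φ : Module.Dual k (W ⟶ Y)), ∃ (B : C) (u : W ⟶ B), (∀ g : B ⟶ Y, φ (u ≫ g) = 0) ∧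
    ∀ (Z : C) (h : W ⟶ Z), (∀ g : Z ⟶ Y, φ (h ≫ g) = 0) → ∃ t : B ⟶ Z, u ≫ t = h

/-- For every linear form `φ` on `C(Y,W)`, the right module of all `h : Z ⟶ W` that are orthogonal
to `C(Y,Z)` with respect to `φ` is generated by one element. It is the kernel of the morphism
`C(-,W) ⟶ C(Y,-)*` given by `φ`. -/
def RightAnnihilatorsFG : Prop :=
  ∀ (W Y : C) (φ : Module.Dual k (Y ⟶ W)), ∃ (B : C) (u : B ⟶ W), (∀ g : Y ⟶ B, φ (g ≫ u) = 0) ∧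
    ∀ (Z : C) (h : Z ⟶ W), (∀ g : Y ⟶ Z, φ (g ≫ h) = 0) → ∃ t : Z ⟶ B, t ≫ u = h

/-- The left modules `C(-,X)*` are generated by one element. -/
def DualProjectivesFG : Prop :=
  ∀ X : C, ∃ (A : C) (φ : Module.Dual k (A ⟶ X)), ∀ (Z : C) (ψ : Module.Dual k (Z ⟶ X)),
    ∃ a : A ⟶ Z, ∀ g : Z ⟶ X, φ (a ≫ g) = ψ g

/-- The right modules `C(X,-)*` are generated by one element. -/
def InjectivesFG : Prop :=
  ∀ X : C, ∃ (A : C) (φ : Module.Dual k (X ⟶ A)), ∀ (Z : C) (ψ : Module.Dual k (X ⟶ Z)),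
    ∃ a : Z ⟶ A, ∀ g : X ⟶ Z, φ (g ≫ a) = ψ g

end Forms

/-! ### Almost split maps and their effect on dimensions -/

section

variable {k : Type v} [Field k] {C : Type u} [Category.{v} C] [Preadditive C] [Linear k C]

/-- The mono part of the generator generates the same module; it stays orthogonal because the
discarded factor has a section. -/
theorem RightAnnihilatorsFG.exists_mono (hr : RightAnnihilatorsFG k C)
    (H : ImagesSplitOff C) {W Y : C} (φ : Module.Dual k (Y ⟶ W)) :
    ∃ (B : C) (u : B ⟶ W), Mono u ∧ (∀ g : Y ⟶ B, φ (g ≫ u) = 0) ∧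
      ∀ (Z : C) (h : Z ⟶ W), (∀ g : Y ⟶ Z, φ (g ≫ h) = 0) → ∃ t : Z ⟶ B, t ≫ u = h := by
  obtain ⟨B, u, hu, huniv⟩ := hr W Y φ
  obtain ⟨B', p, i, hp, hi, rfl⟩ := H u
  refine ⟨B', i, hi, fun g => ?_, fun Z h hh => ?_⟩
  · simpa using hu (g ≫ section_ p)
  · obtain ⟨t, ht⟩ := huniv Z h hh
    exact ⟨t ≫ p, by simpa using ht⟩

theorem finrank_eq_of_isAlmostSplitFrom {X Z : C} (hX : IsEmpty (Retract Z X)) {L : C}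
    {l : Z ⟶ L} (he : Epi l) (hl : IsAlmostSplitFrom l) :
    Module.finrank k (L ⟶ X) = Module.finrank k (Z ⟶ X) := by
  refine LinearEquiv.finrank_eq (LinearEquiv.ofBijective (Linear.leftComp k X l) ⟨?_, ?_⟩)
  · intro a b hab
    simpa [cancel_epi] using hab
  · intro g
    exact hl.2 X g fun hg => hX.false ⟨g, retraction g, by simp⟩

theorem finrank_eq_of_isAlmostSplitTo {X Z : C} (hX : IsEmpty (Retract Z X)) {R : C}
    {r : R ⟶ Z} (hm : Mono r) (hr : IsAlmostSplitTo r) :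
    Module.finrank k (X ⟶ R) = Module.finrank k (X ⟶ Z) := by
  refine LinearEquiv.finrank_eq (LinearEquiv.ofBijective (Linear.rightComp k X r) ⟨?_, ?_⟩)
  · intro a b hab
    simpa [cancel_mono] using hab
  · intro g
    exact hr.2 X g fun hg => hX.false ⟨section_ g, g, by simp⟩

variable [HasBinaryBiproducts C]

theorem id_ne_zero_of_indecomposable {X : C} (hX : Indecomposable X) : 𝟙 X ≠ 0 :=
  fun h => hX.1 ((IsZero.iff_id_eq_zero X).2 h)

theorem exists_ne_zero_of_interval {X Y Z : C} (hZ : Indecomposable Z) (h : interval X Y Z) :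
    ∃ (f : X ⟶ Z) (g : Z ⟶ Y), f ≠ 0 ∧ g ≠ 0 := by
  obtain ⟨h1, h2⟩ := h Z hZ ⟨Retract.refl Z⟩
  obtain ⟨f, hf⟩ := exists_ne (0 : X ⟶ Z)
  obtain ⟨g, hg⟩ := exists_ne (0 : Z ⟶ Y)
  exact ⟨f, g, hf, hg⟩

/-- The exceptional object comes from a resolution `0 → C(-,B) → C(-,A) → C(X,-)* → 0`. If `Z` is
not a summand of `A ⊞ B`, then `l` induces bijections on `C(-,A)` and `C(-,B)`, hence on the
cokernel. -/
theorem exists_finrank_eq_of_isAlmostSplitFrom (hfin : HomFinite k C)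
    (H : ImagesSplitOff C) (hr : RightAnnihilatorsFG k C) (hp : InjectivesFG k C) (X : C) :
    ∃ E : C, ∀ Z : C, IsEmpty (Retract Z E) → ∀ (L : C) (l : Z ⟶ L), Epi l →
      IsAlmostSplitFrom l → Module.finrank k (X ⟶ L) = Module.finrank k (X ⟶ Z) := by
  obtain ⟨A, φ, hφ⟩ := hp X
  obtain ⟨B, u, -, hu0, hu⟩ := hr.exists_mono H φ
  refine ⟨A ⊞ B, fun Z hZ L l hl hs => ?_⟩
  have hA (a : Z ⟶ A) : ¬ IsSplitMono a := fun ha =>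
    hZ.false ⟨a ≫ biprod.inl, biprod.fst ≫ retraction a, by simp⟩
  have hB (a : Z ⟶ B) : ¬ IsSplitMono a := fun ha =>
    hZ.false ⟨a ≫ biprod.inr, biprod.snd ≫ retraction a, by simp⟩
  have := hfin X L
  have := hfin X Z
  refine (LinearEquiv.finrank_eq (LinearEquiv.ofBijective (Linear.rightComp k X l) ⟨?_, ?_⟩)).symm
  · rw [← LinearMap.ker_eq_bot, LinearMap.ker_eq_bot']
    intro g hg
    change g ≫ l = 0 at hg
    refine (Module.forall_dual_apply_eq_zero_iff k g).1 fun ψ => ?_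
    obtain ⟨a, ha⟩ := hφ Z ψ
    obtain ⟨a', rfl⟩ := hs.2 A a (hA a)
    rw [← ha, reassoc_of% hg, zero_comp, map_zero]
  · by_contra hsurj
    rw [← LinearMap.range_eq_top] at hsurj
    -- A form on `C(X,L)` that vanishes on the image is given by some `a : L ⟶ A`. Then `l ≫ a`
    -- factors through `u`, and cancelling `l` makes `a` do so too, so the form is zero.
    obtain ⟨ψ, hψ, hle⟩ := Submodule.exists_le_ker_of_lt_top _ (lt_top_iff_ne_top.2 hsurj)
    obtain ⟨a, ha⟩ := hφ L ψ
    obtain ⟨t, ht⟩ := hu Z (l ≫ a) fun g => by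
      rw [← Category.assoc, ha]
      exact hle ⟨g, rfl⟩
    obtain ⟨t', rfl⟩ := hs.2 B t (hB t)
    have hat : t' ≫ u = a := by rw [← cancel_epi l, ← ht, Category.assoc]
    refine hψ (LinearMap.ext fun g => ?_)
    rw [← ha, ← hat, ← Category.assoc, hu0, LinearMap.zero_apply]

variable [IsIdempotentComplete C]

theorem LeftAnnihilatorsFG.exists_epi (hl : LeftAnnihilatorsFG k C)
    (hfin : HomFinite k C) (H : ImagesSplitOff C) {W Y : C} (φ : Module.Dual k (W ⟶ Y)) :
    ∃ (B : C) (u : W ⟶ B), Epi u ∧ (∀ g : B ⟶ Y, φ (u ≫ g) = 0) ∧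
      ∀ (Z : C) (h : W ⟶ Z), (∀ g : Z ⟶ Y, φ (h ≫ g) = 0) → ∃ t : B ⟶ Z, u ≫ t = h := by
  obtain ⟨B, u, hu, huniv⟩ := hl W Y φ
  obtain ⟨B', p, i, hp, hi, rfl⟩ := H.exists_epi_splitMono hfin u
  refine ⟨B', p, hp, fun g => ?_, fun Z h hh => ?_⟩
  · simpa using hu (retraction i ≫ g)
  · obtain ⟨t, ht⟩ := huniv Z h hh
    exact ⟨i ≫ t, by simpa using ht⟩

/-- Take a form on `End Z` that is nonzero at the identity. If `g` is not split epi, every `s ≫ g`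
in `End Z` is noninvertible, hence zero; so the maps orthogonal to the form are exactly the nonsplit
ones. -/
theorem exists_isAlmostSplitTo (hfin : HomFinite k C) (H : ImagesSplitOff C)
    (hr : RightAnnihilatorsFG k C) {Z : C} (hZ : Indecomposable Z) :
    ∃ (R : C) (r : R ⟶ Z), Mono r ∧ IsAlmostSplitTo r := by
  obtain ⟨φ, hφ⟩ := Module.Projective.exists_dual_ne_zero k (id_ne_zero_of_indecomposable hZ)
  obtain ⟨R, r, hm, h0, hu⟩ := hr.exists_mono H φ
  refine ⟨R, r, hm, fun hs => hφ ?_, fun B g hg => hu B g fun s => ?_⟩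
  · simpa using h0 (section_ r)
  · by_cases h : s ≫ g = 0
    · rw [h, map_zero]
    · have := isIso_of_endo_ne_zero hfin H hZ h
      exact (hg ⟨⟨⟨inv (s ≫ g) ≫ s, by simp⟩⟩⟩).elim

theorem exists_isAlmostSplitFrom (hfin : HomFinite k C) (H : ImagesSplitOff C)
    (hl : LeftAnnihilatorsFG k C) {Z : C} (hZ : Indecomposable Z) :
    ∃ (L : C) (l : Z ⟶ L), Epi l ∧ IsAlmostSplitFrom l := by
  obtain ⟨φ, hφ⟩ := Module.Projective.exists_dual_ne_zero k (id_ne_zero_of_indecomposable hZ)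
  obtain ⟨R, r, hm, h0, hu⟩ := hl.exists_epi hfin H φ
  refine ⟨R, r, hm, fun hs => hφ ?_, fun B g hg => hu B g fun s => ?_⟩
  · simpa using h0 (retraction r)
  · by_cases h : g ≫ s = 0
    · rw [h, map_zero]
    · have := isIso_of_endo_ne_zero hfin H hZ h
      exact (hg ⟨⟨⟨s ≫ inv (g ≫ s), by rw [← Category.assoc, IsIso.hom_inv_id]⟩⟩⟩).elim

/-- Off the summands of one object, the inclusion of the radical does not change the dimension of
`C(-,X)`. -/
theorem exists_finrank_eq_of_isAlmostSplitTo (hfin : HomFinite k C)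
    (H : ImagesSplitOff C) (hl : LeftAnnihilatorsFG k C) (hp : DualProjectivesFG k C) (X : C) :
    ∃ E : C, ∀ Z : C, IsEmpty (Retract Z E) → ∀ (R : C) (r : R ⟶ Z), Mono r →
      IsAlmostSplitTo r → Module.finrank k (R ⟶ X) = Module.finrank k (Z ⟶ X) := by
  obtain ⟨A, φ, hφ⟩ := hp X
  obtain ⟨B, u, -, hu0, hu⟩ := hl.exists_epi hfin H φ
  refine ⟨A ⊞ B, fun Z hZ R r hr hs => ?_⟩
  have hA (a : A ⟶ Z) : ¬ IsSplitEpi a := fun ha =>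
    hZ.false ⟨section_ a ≫ biprod.inl, biprod.fst ≫ a, by simp⟩
  have hB (a : B ⟶ Z) : ¬ IsSplitEpi a := fun ha =>
    hZ.false ⟨section_ a ≫ biprod.inr, biprod.snd ≫ a, by simp⟩
  have := hfin R X
  have := hfin Z X
  refine (LinearEquiv.finrank_eq (LinearEquiv.ofBijective (Linear.leftComp k X r) ⟨?_, ?_⟩)).symm
  · rw [← LinearMap.ker_eq_bot, LinearMap.ker_eq_bot']
    intro g hg
    change r ≫ g = 0 at hg
    refine (Module.forall_dual_apply_eq_zero_iff k g).1 fun ψ => ?_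
    obtain ⟨a, ha⟩ := hφ Z ψ
    obtain ⟨a', rfl⟩ := hs.2 A a (hA a)
    rw [← ha, Category.assoc, hg, comp_zero, map_zero]
  · by_contra hsurj
    rw [← LinearMap.range_eq_top] at hsurj
    obtain ⟨ψ, hψ, hle⟩ := Submodule.exists_le_ker_of_lt_top _ (lt_top_iff_ne_top.2 hsurj)
    obtain ⟨a, ha⟩ := hφ R ψ
    obtain ⟨t, ht⟩ := hu Z (a ≫ r) fun g => by
      rw [Category.assoc, ha]
      exact hle ⟨g, rfl⟩
    obtain ⟨t', rfl⟩ := hs.2 B t (hB t)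
    have hat : u ≫ t' = a := by rw [← cancel_mono r, ← ht, Category.assoc]
    refine hψ (LinearMap.ext fun g => ?_)
    rw [← ha, ← hat, Category.assoc, hu0, LinearMap.zero_apply]

/-! ### Threads -/

theorem interval_of_comp {X Y Z : C} (hZ : Indecomposable Z) {f : X ⟶ Z} {g : Z ⟶ Y}
    (hf : f ≠ 0) (hg : g ≠ 0) : interval X Y Z := by
  rintro W hW ⟨ρ⟩
  have := isIso_of_isSplitMono_of_indecomposable hZ hW.1 ρ.i
  refine ⟨nontrivial_of_ne (f ≫ inv ρ.i) 0 fun h => hf ?_,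
    nontrivial_of_ne (ρ.i ≫ g) 0 fun h => hg ?_⟩
  · rw [← cancel_mono (inv ρ.i), h, zero_comp]
  · rw [← cancel_epi ρ.i, h, comp_zero]

/-- The almost split map to `Z` from a thread object `R` is also the almost split map starting
at `R`. -/
theorem isAlmostSplitFrom_of_isAlmostSplitTo (H : ImagesSplitOff C) {R Z : C} {r : R ⟶ Z}
    (hR : IsThreadObject R) (hZ : Indecomposable Z) (h0 : r ≠ 0) (hr : IsAlmostSplitTo r) :
    IsAlmostSplitFrom r := by
  obtain ⟨hRi, ⟨L, l, hL, -, hl⟩, -⟩ := hR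
  have hmono := H.mono_of_ne_zero hRi h0
  have hns : ¬ IsSplitMono r := fun hs => hr.1 <| by
    have := isIso_of_isSplitMono_of_indecomposable hZ hRi.1 r
    infer_instance
  obtain ⟨s, rfl⟩ := hl.2 Z r hns
  -- Otherwise `s` factors through `r = l ≫ s`, and cancelling this monomorphism would split `l`.
  have hs : IsSplitEpi s := by
    by_contra hs
    obtain ⟨s', hs'⟩ := hr.2 L s hs
    refine hl.1 ⟨⟨⟨s', ?_⟩⟩⟩
    rw [← cancel_mono (l ≫ s), Category.assoc, hs', Category.id_comp]
  have := isIso_of_isSplitEpi_of_indecomposable hL hZ.1 s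
  refine ⟨hns, fun B g hg => ?_⟩
  obtain ⟨t, rfl⟩ := hl.2 B g hg
  exact ⟨inv s ≫ t, by simp⟩

/-- Along a thread `[X,Y]`, the annihilator of a nonzero form on `C(X,T)` vanishes. -/
theorem eq_zero_of_isThread [IsAlgClosed k] (hfin : HomFinite k C)
    (H : ImagesSplitOff C) (hl : LeftAnnihilatorsFG k C) {X Y T : C} (hX : Indecomposable X)
    (hTi : Indecomposable T) (hXY : IsThread X Y) {φ : Module.Dual k (X ⟶ T)} (hφ : φ ≠ 0)
    (hT : ∀ f : T ⟶ Y, f ≠ 0 → IsIso f) {h : X ⟶ Y} (hh : ∀ g : Y ⟶ T, φ (h ≫ g) = 0) :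
    h = 0 := by
  by_contra hne
  obtain ⟨B, u, hu, hu0, huniv⟩ := hl.exists_epi hfin H φ
  obtain ⟨t, rfl⟩ := huniv Y h hh
  have ht : t ≠ 0 := fun h => hne (by rw [h, comp_zero])
  -- `A` is a summand of `B` lying on a nonzero path `X ⟶ A ⟶ Y`, hence in the thread.
  obtain ⟨A, i, p, hA, hip, hit⟩ := exists_indecomposable_retract_comp_ne_zero hfin ht
  have : IsSplitEpi p := ⟨⟨⟨i, hip⟩⟩⟩
  have hup0 (g : A ⟶ T) : φ ((u ≫ p) ≫ g) = 0 := by simpa using hu0 (p ≫ g)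
  have hup : u ≫ p ≠ 0 := fun h0 => id_ne_zero_of_indecomposable hA <| by
    rw [← cancel_epi (u ≫ p), h0, zero_comp, zero_comp]
  have hns : ¬ IsSplitEpi (u ≫ p) := fun hs => hφ <| by
    have := isIso_of_isSplitEpi_of_indecomposable hX hA.1 (u ≫ p)
    refine LinearMap.ext fun g => ?_
    simpa using hup0 (inv (u ≫ p) ≫ g)
  obtain ⟨-, -, R, r, hR, hr0, hr⟩ := hXY A hA (interval_of_comp hA hup hit)
  obtain ⟨s, hs⟩ := hr.2 X (u ≫ p) hns
  have hs0 : s ≠ 0 := fun h => hup (by rw [← hs, h, zero_comp])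
  have hrit : r ≫ i ≫ t ≠ 0 := H.comp_ne_zero hA hr0 hit
  have hRt := hXY R hR (interval_of_comp hR hs0 hrit)
  have hrs := isAlmostSplitFrom_of_isAlmostSplitTo H hRt hA hr0 hr
  have hmono := H.mono_of_ne_zero hR hr0
  -- `s` is again orthogonal to `φ`: a nonsplit `g : R ⟶ T` factors through `r`, where `s ≫ r = u ≫
  -- p` is orthogonal. If `g` splits, then `R ≅ T`, and `hT` makes `R ⟶ A ⟶ Y` invertible, so `r`
  -- would split.
  obtain ⟨t', ht'⟩ := huniv R s fun g => by
    by_cases hg : IsSplitMono g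
    · exfalso
      have := isIso_of_isSplitMono_of_indecomposable hTi hR.1 g
      have := hT (inv g ≫ r ≫ i ≫ t) fun h0 => hrit <| by
        rw [← cancel_epi (inv g), h0, comp_zero]
      have hiso : IsIso (r ≫ i ≫ t) := IsIso.of_isIso_comp_left (inv g) _
      exact hrs.1 ⟨⟨⟨(i ≫ t) ≫ inv (r ≫ i ≫ t), by
        rw [← Category.assoc, IsIso.hom_inv_id]⟩⟩⟩
    · obtain ⟨g', rfl⟩ := hrs.2 T g hg
      rw [← Category.assoc, hs, hup0]
  refine hr.1 ⟨⟨⟨i ≫ t', ?_⟩⟩⟩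
  have : t' ≫ r = p := by rw [← cancel_epi u, ← Category.assoc, ht', hs]
  rw [Category.assoc, this, hip]

/-- If `[X,Y]` is a nonempty thread, then `C(X,Y)` is one-dimensional. -/
theorem finrank_eq_one_of_isThread [IsAlgClosed k] (hfin : HomFinite k C)
    (H : ImagesSplitOff C) (hl : LeftAnnihilatorsFG k C) {X Y : C} (hX : Indecomposable X)
    (hY : Indecomposable Y) (hXY : IsThread X Y)
    (hne : ∃ W : C, Indecomposable W ∧ interval X Y W) : Module.finrank k (X ⟶ Y) = 1 := by
  obtain ⟨W, hW, hXW⟩ := hne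
  obtain ⟨f, g, hf, hg⟩ := exists_ne_zero_of_interval hW hXW
  have hfg := H.comp_ne_zero hW hf hg
  obtain ⟨φ, hφ⟩ := Module.Projective.exists_dual_ne_zero k hfg
  have hφ0 : φ ≠ 0 := fun h => hφ (by rw [h, LinearMap.zero_apply])
  have := hfin X Y
  have hinj : Function.Injective φ := by
    rw [← LinearMap.ker_eq_bot, LinearMap.ker_eq_bot']
    intro h hh
    -- With `T = Y`, orthogonality of `h` only asks for `φ h = 0`, because `End Y` consists of
    -- scalars.
    refine eq_zero_of_isThread hfin H hl hX hY hXY hφ0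
      (fun f hf => isIso_of_endo_ne_zero hfin H hY hf) fun e => ?_
    obtain ⟨c, rfl⟩ := exists_smul_id_eq hfin H hY e
    simp [hh]
  refine le_antisymm ?_ ?_
  · simpa using LinearMap.finrank_le_finrank_of_injective hinj
  · have : Nontrivial (X ⟶ Y) := nontrivial_of_ne _ _ hfg
    exact Module.finrank_pos

theorem interval_le_interval (H : ImagesSplitOff C) {X Y Z : C} (hY : Indecomposable Y)
    {f : Y ⟶ Z} (hf : f ≠ 0) : interval X Y ≤ interval X Z := fun W hW V hV hVW => by
  obtain ⟨h1, h2⟩ := hW V hV hVW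
  obtain ⟨g, hg⟩ := exists_ne (0 : V ⟶ Y)
  exact ⟨h1, nontrivial_of_ne _ _ (H.comp_ne_zero hY hg hf)⟩

/-- Threads with a common starting object are comparable. -/
theorem interval_le_or_le_of_isThread [IsAlgClosed k] (hfin : HomFinite k C)
    (H : ImagesSplitOff C) (hl : LeftAnnihilatorsFG k C) {X Y Z : C} (hX : Indecomposable X)
    (hY : Indecomposable Y) (hZ : Indecomposable Z) (hXY : IsThread X Y) :
    interval X Y ≤ interval X Z ∨ interval X Z ≤ interval X Y := by
  by_cases h1 : ∃ f : Y ⟶ Z, f ≠ 0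
  · obtain ⟨f, hf⟩ := h1
    exact Or.inl (interval_le_interval H hY hf)
  by_cases h2 : ∃ f : Z ⟶ Y, f ≠ 0
  · obtain ⟨f, hf⟩ := h2
    exact Or.inr (interval_le_interval H hZ hf)
  push Not at h1 h2
  by_cases h3 : ∃ f : X ⟶ Z, f ≠ 0
  · obtain ⟨f, hf⟩ := h3
    obtain ⟨φ, hφ⟩ := Module.Projective.exists_dual_ne_zero k hf
    have hφ0 : φ ≠ 0 := fun h => hφ (by rw [h, LinearMap.zero_apply])
    refine Or.inl fun W hW V hV hVW => ?_
    obtain ⟨hXV, hVY⟩ := hW V hV hVW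
    obtain ⟨a, ha⟩ := exists_ne (0 : X ⟶ V)
    obtain ⟨b, hb⟩ := exists_ne (0 : V ⟶ Y)
    refine absurd ?_ (H.comp_ne_zero hV ha hb)
    -- With `T = Z` both conditions are trivial, as there are no nonzero maps between `Y` and `Z` in
    -- either direction.
    refine eq_zero_of_isThread hfin H hl hX hZ hXY hφ0 (fun f hf => absurd (h2 f) hf) fun g => ?_
    rw [h1 g, comp_zero, map_zero]
  · push Not at h3
    refine Or.inr fun W hW V hV hVW => ?_
    obtain ⟨hXV, hVZ⟩ := hW V hV hVW
    obtain ⟨a, ha⟩ := exists_ne (0 : X ⟶ V)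
    obtain ⟨b, hb⟩ := exists_ne (0 : V ⟶ Z)
    exact absurd (h3 _) (H.comp_ne_zero hV ha hb)

end

/-! ### Counting nonthread objects with an additive dimension function -/

section Nonthread

variable {C : Type u} [Category.{v} C]

/-- An object is a summand of the direct predecessors of its direct successors. -/
theorem nonempty_retract_of_isAlmostSplit {Z L W R : C} {l : Z ⟶ L} {r : R ⟶ W} [Epi l]
    (hl : IsAlmostSplitFrom l) (hr : IsAlmostSplitTo r) (hW : Retract W L)
    (hZiso : ∀ f : Z ⟶ W, IsSplitEpi f → IsSplitMono f) : Nonempty (Retract Z R) := by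
  have hns : ¬ IsSplitEpi (l ≫ hW.r) := fun h => hl.1 <| by
    have := hZiso _ h
    exact ⟨⟨⟨hW.r ≫ retraction (l ≫ hW.r), by
      rw [← Category.assoc, IsSplitMono.id]⟩⟩⟩
  obtain ⟨s, hs⟩ := hr.2 Z _ hns
  by_cases hsm : IsSplitMono s
  · exact ⟨⟨s, retraction s, by simp⟩⟩
  -- Cancelling `l` shows that `s'` lifts the projection `L ⟶ W` through `r`, which would split `r`.
  · obtain ⟨s', rfl⟩ := hl.2 R s hsm
    refine (hr.1 ⟨⟨⟨hW.i ≫ s', ?_⟩⟩⟩).elim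
    rw [Category.assoc, cancel_epi] at hs
    rw [Category.assoc, hs, hW.retract]

variable [Preadditive C] [HasBinaryBiproducts C]

/-- An object `M` whose dimension is positive is indecomposable if no summand of `M` has
smaller dimension. -/
theorem indecomposable_of_dim_le {d : C → ℕ} {n : ℕ}
    (hsum : ∀ X Y Z : C, (X ≅ Y ⊞ Z) → d X = d Y + d Z)
    (hretr : ∀ X : C, ¬ IsZero X → ∃ A : C, Indecomposable A ∧ Nonempty (Retract A X))
    (hle : ∀ A X : C, Nonempty (Retract A X) → d A ≤ d X) {M : C} (hn : 0 < n) (hM : d M = n)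
    (hA : ∀ A : C, Indecomposable A → Nonempty (Retract A M) → n ≤ d A) : Indecomposable M := by
  have h0 {X : C} (hX : IsZero X) : d X = 0 := by
    have := hsum X X X ⟨biprod.inl, biprod.fst, by simp, by
      ext <;> exact hX.eq_of_src _ _⟩
    omega
  refine ⟨fun h => by have := h0 h; omega, fun Y Z e => ?_⟩
  by_contra! hcon
  have key {Y : C} (hY : ¬ IsZero Y) (r : Retract Y M) : n ≤ d Y := by
    obtain ⟨A, hAi, ⟨ρ⟩⟩ := hretr Y hY
    exact (hA A hAi ⟨ρ.trans r⟩).trans (hle A Y ⟨ρ⟩)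
  have h1 := key hcon.1 ⟨biprod.inl ≫ e.inv, e.hom ≫ biprod.fst, by simp⟩
  have h2 := key hcon.2 ⟨biprod.inr ≫ e.inv, e.hom ≫ biprod.snd, by simp⟩
  have := hsum M Y Z e
  omega

theorem indecomposable_of_iso {X Y : C} (hX : Indecomposable X) (e : X ≅ Y) : Indecomposable Y :=
  ⟨fun h => hX.1 (h.of_iso e), fun A B e' => hX.2 A B (e ≪≫ e')⟩

/-- Let `d` be an additive function that decreases along nonzero maps between indecomposable
objects and that, with finitely many exceptions, does not change along almost split maps. Then
`d` is nonzero at finitely many nonthread objects only. -/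
theorem finitelyManyUpToIso_nonthread {d : C → ℕ}
    (hsum : ∀ X Y Z : C, (X ≅ Y ⊞ Z) → d X = d Y + d Z)
    (hretr : ∀ X : C, ¬ IsZero X → ∃ A : C, Indecomposable A ∧ Nonempty (Retract A X))
    (hle : ∀ A X : C, Nonempty (Retract A X) → d A ≤ d X)
    (hfinr : ∀ E : C, FinitelyManyUpToIso fun A : C => Indecomposable A ∧ Nonempty (Retract A E))
    (hdec : ∀ (A B : C) (f : A ⟶ B), Indecomposable A → Indecomposable B → f ≠ 0 → d B ≤ d A)
    (hsplit : ∀ (A B : C), Indecomposable A → Indecomposable B → ∀ f : A ⟶ B,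
      IsSplitEpi f → IsSplitMono f)
    (hto : ∀ Z : C, Indecomposable Z → ∃ (R : C) (r : R ⟶ Z), Mono r ∧ IsAlmostSplitTo r)
    (hfrom : ∀ Z : C, Indecomposable Z → ∃ (L : C) (l : Z ⟶ L), Epi l ∧ IsAlmostSplitFrom l)
    (hdto : ∃ E : C, ∀ Z : C, IsEmpty (Retract Z E) → ∀ (R : C) (r : R ⟶ Z), Mono r →
      IsAlmostSplitTo r → d R = d Z)
    (hdfrom : ∃ E : C, ∀ Z : C, IsEmpty (Retract Z E) → ∀ (L : C) (l : Z ⟶ L), Epi l →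
      IsAlmostSplitFrom l → d L = d Z) :
    FinitelyManyUpToIso fun Z : C => 0 < d Z ∧ IsNonthreadObject Z := by
  classical
  obtain ⟨E₁, hE₁⟩ := hdto
  obtain ⟨E₂, hE₂⟩ := hdfrom
  obtain ⟨S₁, hS₁⟩ := hfinr E₁
  obtain ⟨S₂, hS₂⟩ := hfinr E₂
  choose R r hrm hr using hto
  choose T hT using hfinr
  let pred : C → Finset C := fun W => if h : Indecomposable W then T (R W h) else ∅
  -- Avoiding `pred` ensures that no summand of the successor `L` of `Z` is exceptional for `hdto`.
  refine ⟨S₁ ∪ S₂ ∪ S₁.biUnion pred, fun Z ⟨hpos, hZ, hnt⟩ => ?_⟩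
  by_contra hcon
  push Not at hcon
  have h1 : IsEmpty (Retract Z E₁) := ⟨fun ρ => by
    obtain ⟨W, hW, ⟨e⟩⟩ := hS₁ Z ⟨hZ, ⟨ρ⟩⟩
    exact (hcon W (by simp [hW])).false e⟩
  have h2 : IsEmpty (Retract Z E₂) := ⟨fun ρ => by
    obtain ⟨W, hW, ⟨e⟩⟩ := hS₂ Z ⟨hZ, ⟨ρ⟩⟩
    exact (hcon W (by simp [hW])).false e⟩
  obtain ⟨L, l, hle', hl⟩ := hfrom Z hZ
  have hret {W : C} (hW : Indecomposable W) (ρ : Retract W L) : Nonempty (Retract Z (R W hW)) :=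
    nonempty_retract_of_isAlmostSplit hl (hr W hW) ρ (hsplit Z W hZ hW)
  have hL : Indecomposable L := by
    refine indecomposable_of_dim_le hsum hretr hle hpos (hE₂ Z h2 L l hle' hl) fun A hA ⟨ρ⟩ => ?_
    have hAE : IsEmpty (Retract A E₁) := ⟨fun σ => by
      obtain ⟨W, hW, ⟨e⟩⟩ := hS₁ A ⟨hA, ⟨σ⟩⟩
      have hWi := indecomposable_of_iso hA e
      obtain ⟨V, hV, ⟨e'⟩⟩ := hT _ Z ⟨hZ, hret hWi ((Retract.ofIso e.symm).trans ρ)⟩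
      refine (hcon V ?_).false e'
      have hVp : V ∈ pred W := by simpa [pred, hWi] using hV
      exact Finset.mem_union_right _ (Finset.mem_biUnion.2 ⟨W, hW, hVp⟩)⟩
    -- `d A` is the dimension of the predecessor of `A`, which has `Z` as a summand.
    rw [← hE₁ A hAE _ _ (hrm A hA) (hr A hA)]
    exact hle _ _ (hret hA ρ)
  have hR : Indecomposable (R Z hZ) := by
    refine indecomposable_of_dim_le hsum hretr hle hpos (hE₁ Z h1 _ _ (hrm Z hZ) (hr Z hZ))
      fun A hA ⟨ρ⟩ => hdec A Z (ρ.i ≫ r Z hZ) hA hZ fun h => hA.1 ?_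
    have := hrm Z hZ
    have h0 : ρ.i = 0 := by rw [← cancel_mono (r Z hZ), h, zero_comp]
    rw [IsZero.iff_id_eq_zero, ← ρ.retract, h0, zero_comp]
  refine hnt ⟨hZ, ⟨L, l, hL, fun h => hL.1 ?_, hl⟩, ⟨R Z hZ, r Z hZ, hR, fun h => hR.1 ?_, hr Z hZ⟩⟩
  · rw [IsZero.iff_id_eq_zero, ← cancel_epi l, h, zero_comp, zero_comp]
  · have := hrm Z hZ
    rw [IsZero.iff_id_eq_zero, ← cancel_mono (r Z hZ), h, comp_zero, comp_zero]

end Nonthread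

/-! ### Passage to the opposite category -/

section Opposite

variable {C : Type u} [Category.{v} C]

theorem isSplitMono_op_iff {X Y : C} (f : X ⟶ Y) : IsSplitMono f.op ↔ IsSplitEpi f :=
  ⟨fun _ => ⟨⟨⟨(retraction f.op).unop, Quiver.Hom.op_inj (IsSplitMono.id f.op)⟩⟩⟩,
    fun _ => inferInstance⟩

theorem isSplitEpi_op_iff {X Y : C} (f : X ⟶ Y) : IsSplitEpi f.op ↔ IsSplitMono f :=
  ⟨fun _ => ⟨⟨⟨(section_ f.op).unop, Quiver.Hom.op_inj (IsSplitEpi.id f.op)⟩⟩⟩,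
    fun _ => inferInstance⟩

theorem isAlmostSplitFrom_op_iff {X Y : C} (f : X ⟶ Y) :
    IsAlmostSplitFrom f.op ↔ IsAlmostSplitTo f := by
  simp only [IsAlmostSplitFrom, IsAlmostSplitTo, isSplitMono_op_iff]
  refine and_congr_right fun _ => ⟨fun h B g hg => ?_, fun h B g hg => ?_⟩
  · obtain ⟨t, ht⟩ := h (op B) g.op (by rwa [isSplitMono_op_iff])
    exact ⟨t.unop, Quiver.Hom.op_inj ht⟩
  · obtain ⟨t, ht⟩ := h B.unop g.unop (by rwa [← isSplitMono_op_iff])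
    exact ⟨t.op, Quiver.Hom.unop_inj ht⟩

theorem isAlmostSplitTo_op_iff {X Y : C} (f : X ⟶ Y) :
    IsAlmostSplitTo f.op ↔ IsAlmostSplitFrom f := by
  simp only [IsAlmostSplitFrom, IsAlmostSplitTo, isSplitEpi_op_iff]
  refine and_congr_right fun _ => ⟨fun h B g hg => ?_, fun h B g hg => ?_⟩
  · obtain ⟨t, ht⟩ := h (op B) g.op (by rwa [isSplitEpi_op_iff])
    exact ⟨t.unop, Quiver.Hom.op_inj ht⟩
  · obtain ⟨t, ht⟩ := h B.unop g.unop (by rwa [← isSplitEpi_op_iff])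
    exact ⟨t.op, Quiver.Hom.unop_inj ht⟩

theorem nonempty_retract_op_iff {X Y : C} :
    Nonempty (Retract (op X) (op Y)) ↔ Nonempty (Retract X Y) :=
  ⟨fun ⟨ρ⟩ => ⟨⟨ρ.r.unop, ρ.i.unop, Quiver.Hom.op_inj ρ.retract⟩⟩,
    fun ⟨ρ⟩ => ⟨⟨ρ.r.op, ρ.i.op, Quiver.Hom.unop_inj ρ.retract⟩⟩⟩

theorem FinitelyManyUpToIso.op {P : C → Prop} (h : FinitelyManyUpToIso P) :
    FinitelyManyUpToIso fun Z : Cᵒᵖ => P Z.unop := by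
  classical
  obtain ⟨S, hS⟩ := h
  refine ⟨S.image Opposite.op, fun Z hZ => ?_⟩
  obtain ⟨W, hW, ⟨e⟩⟩ := hS Z.unop hZ
  exact ⟨Opposite.op W, Finset.mem_image_of_mem _ hW, ⟨e.symm.op⟩⟩

theorem FinitelyManyUpToIso.unop {P : Cᵒᵖ → Prop} (h : FinitelyManyUpToIso P) :
    FinitelyManyUpToIso fun Z : C => P (Opposite.op Z) := by
  classical
  obtain ⟨S, hS⟩ := h
  refine ⟨S.image Opposite.unop, fun Z hZ => ?_⟩
  obtain ⟨W, hW, ⟨e⟩⟩ := hS (Opposite.op Z) hZ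
  exact ⟨W.unop, Finset.mem_image_of_mem _ hW, ⟨e.symm.unop⟩⟩

theorem FinitelyManyUpToIso.mono {P Q : C → Prop} (h : FinitelyManyUpToIso P)
    (hQ : ∀ Z, Q Z → P Z) : FinitelyManyUpToIso Q :=
  h.imp fun _ hS Z hZ => hS Z (hQ Z hZ)

variable [Preadditive C] [HasBinaryBiproducts C] [IsIdempotentComplete C]

/-- A self-dual description, used to pass indecomposability to `Cᵒᵖ` without comparing biproducts.
-/
theorem indecomposable_iff_idempotents {X : C} :
    Indecomposable X ↔ ¬ IsZero X ∧ ∀ e : X ⟶ X, e ≫ e = e → e = 0 ∨ e = 𝟙 X := by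
  refine ⟨fun hX => ⟨hX.1, fun e he => ?_⟩, fun ⟨h0, h⟩ => ⟨h0, fun Y Z e => ?_⟩⟩
  · obtain ⟨Y, i, p, hip, rfl⟩ := IsIdempotentComplete.idempotents_split X e he
    by_cases hY : IsZero Y
    · exact Or.inl (by rw [hY.eq_of_tgt p 0, zero_comp])
    · have : IsSplitEpi p := ⟨⟨⟨i, hip⟩⟩⟩
      have := isIso_of_isSplitEpi_of_indecomposable hX hY p
      refine Or.inr ?_
      rw [← cancel_mono p, Category.assoc, hip, Category.id_comp, Category.comp_id]
  · rcases h (e.hom ≫ biprod.fst ≫ biprod.inl ≫ e.inv) (by simp) with h1 | h1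
    · refine Or.inl ((IsZero.iff_id_eq_zero Y).2 ?_)
      simpa using congrArg (fun t => (biprod.inl ≫ e.inv) ≫ t ≫ e.hom ≫ biprod.fst) h1
    · refine Or.inr ((IsZero.iff_id_eq_zero Z).2 ?_)
      simpa using (congrArg (fun t => (biprod.inr ≫ e.inv) ≫ t ≫ e.hom ≫ biprod.snd) h1).symm

theorem indecomposable_op_iff {X : C} : Indecomposable (op X) ↔ Indecomposable X := by
  rw [indecomposable_iff_idempotents, indecomposable_iff_idempotents]
  refine and_congr (not_congr ⟨IsZero.unop, IsZero.op⟩)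
    ⟨fun h e he => (h e.op (congrArg Quiver.Hom.op he)).imp (fun h => Quiver.Hom.op_inj h)
      fun h => Quiver.Hom.op_inj h,
    fun h e he => (h e.unop (congrArg Quiver.Hom.unop he)).imp (fun h => Quiver.Hom.unop_inj h)
      fun h => Quiver.Hom.unop_inj h⟩

theorem isThreadObject_of_op {X : C} (h : IsThreadObject (op X)) : IsThreadObject X := by
  obtain ⟨hX, ⟨M, f, hM, hf0, hf⟩, N, g, hN, hg0, hg⟩ := h
  refine ⟨indecomposable_op_iff.1 hX,
    ⟨N.unop, g.unop, indecomposable_op_iff.1 hN, fun h => hg0 (Quiver.Hom.unop_inj h),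
      (isAlmostSplitTo_op_iff _).1 hg⟩,
    ⟨M.unop, f.unop, indecomposable_op_iff.1 hM, fun h => hf0 (Quiver.Hom.unop_inj h),
      (isAlmostSplitFrom_op_iff _).1 hf⟩⟩

end Opposite

/-! ### The dimension functions `dim C(-,X)` and `dim C(X,-)` -/

section Dimensions

variable {k : Type v} [Field k] {C : Type u} [Category.{v} C] [Preadditive C] [Linear k C]

theorem finrank_hom_to_add (hfin : HomFinite k C) (W : C) {X Y Z : C} {i : Y ⟶ X} {p : X ⟶ Y}
    {j : Z ⟶ X} {q : X ⟶ Z} (hip : i ≫ p = 𝟙 Y) (hjq : j ≫ q = 𝟙 Z) (hiq : i ≫ q = 0)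
    (hjp : j ≫ p = 0) (htot : p ≫ i + q ≫ j = 𝟙 X) :
    Module.finrank k (W ⟶ X) = Module.finrank k (W ⟶ Y) + Module.finrank k (W ⟶ Z) := by
  have := hfin W Y
  have := hfin W Z
  rw [← Module.finrank_prod]
  refine LinearEquiv.finrank_eq (LinearEquiv.ofLinearMap
    ((Linear.rightComp k W p).prod (Linear.rightComp k W q))
    ((Linear.rightComp k W i).coprod (Linear.rightComp k W j)) ?_ ?_)
  · ext f <;> simp [hip, hjq, hiq, hjp]
  · ext f
    simp [← Preadditive.comp_add, htot]

theorem finrank_hom_from_add (hfin : HomFinite k C) (W : C) {X Y Z : C} {i : Y ⟶ X} {p : X ⟶ Y}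
    {j : Z ⟶ X} {q : X ⟶ Z} (hip : i ≫ p = 𝟙 Y) (hjq : j ≫ q = 𝟙 Z) (hiq : i ≫ q = 0)
    (hjp : j ≫ p = 0) (htot : p ≫ i + q ≫ j = 𝟙 X) :
    Module.finrank k (X ⟶ W) = Module.finrank k (Y ⟶ W) + Module.finrank k (Z ⟶ W) := by
  have := hfin Y W
  have := hfin Z W
  rw [← Module.finrank_prod]
  refine LinearEquiv.finrank_eq (LinearEquiv.ofLinearMap
    ((Linear.leftComp k W i).prod (Linear.leftComp k W j))
    ((Linear.leftComp k W p).coprod (Linear.leftComp k W q)) ?_ ?_)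
  · ext f <;> simp [reassoc_of% hip, reassoc_of% hjq, reassoc_of% hiq, reassoc_of% hjp]
  · ext f
    change p ≫ i ≫ f + q ≫ j ≫ f = f
    rw [← Category.assoc, ← Category.assoc, ← Preadditive.add_comp, htot, Category.id_comp]

theorem finrank_hom_to_le (hfin : HomFinite k C) (W : C) {A B : C} (f : A ⟶ B) [Mono f] :
    Module.finrank k (W ⟶ A) ≤ Module.finrank k (W ⟶ B) := by
  have := hfin W B
  refine LinearMap.finrank_le_finrank_of_injective (f := Linear.rightComp k W f) fun a b hab => ?_
  simpa [cancel_mono] using hab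

theorem finrank_hom_from_le (hfin : HomFinite k C) (W : C) {A B : C} (f : A ⟶ B) [Epi f] :
    Module.finrank k (B ⟶ W) ≤ Module.finrank k (A ⟶ W) := by
  have := hfin A W
  refine LinearMap.finrank_le_finrank_of_injective (f := Linear.leftComp k W f) fun a b hab => ?_
  simpa [cancel_epi] using hab

variable [HasBinaryBiproducts C] [IsIdempotentComplete C]

theorem isSplitMono_iff_isSplitEpi_of_indecomposable {A B : C} (hA : Indecomposable A)
    (hB : Indecomposable B) (f : A ⟶ B) : IsSplitMono f ↔ IsSplitEpi f :=
  ⟨fun _ => have := isIso_of_isSplitMono_of_indecomposable hB hA.1 f; inferInstance,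
    fun _ => have := isIso_of_isSplitEpi_of_indecomposable hA hB.1 f; inferInstance⟩

theorem finitelyManyUpToIso_nonthread_hom_to (hfin : HomFinite k C) (H : ImagesSplitOff C)
    (hl : LeftAnnihilatorsFG k C) (hr : RightAnnihilatorsFG k C) (hp : DualProjectivesFG k C)
    (X : C) : FinitelyManyUpToIso fun Z : C =>
      0 < Module.finrank k (Z ⟶ X) ∧ IsNonthreadObject Z := by
  refine finitelyManyUpToIso_nonthread (d := fun Z => Module.finrank k (Z ⟶ X))
    ?_ (fun X hX => exists_indecomposable_retract hfin hX) ?_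
    (finitelyManyUpToIso_retract hfin H) ?_
    (fun A B hA hB f h => (isSplitMono_iff_isSplitEpi_of_indecomposable hA hB f).2 h)
    (fun Z hZ => exists_isAlmostSplitTo hfin H hr hZ)
    (fun Z hZ => exists_isAlmostSplitFrom hfin H hl hZ)
    (exists_finrank_eq_of_isAlmostSplitTo hfin H hl hp X)
    ⟨X, fun Z hZ L l he hl => finrank_eq_of_isAlmostSplitFrom hZ he hl⟩
  · intro A B D e
    exact finrank_hom_from_add hfin X (i := biprod.inl ≫ e.inv) (p := e.hom ≫ biprod.fst)
      (j := biprod.inr ≫ e.inv) (q := e.hom ≫ biprod.snd) (by simp) (by simp) (by simp) (by simp)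
      (by rw [← cancel_epi e.inv, ← cancel_mono e.hom]; simp)
  · rintro A B ⟨ρ⟩
    exact finrank_hom_from_le hfin X ρ.r
  · intro A B f hA hB hf
    have := H.epi_of_ne_zero hB hf
    exact finrank_hom_from_le hfin X f

theorem finitelyManyUpToIso_nonthread_hom_from (hfin : HomFinite k C) (H : ImagesSplitOff C)
    (hl : LeftAnnihilatorsFG k C) (hr : RightAnnihilatorsFG k C) (hi : InjectivesFG k C)
    (X : C) : FinitelyManyUpToIso fun Z : C =>
      0 < Module.finrank k (X ⟶ Z) ∧ IsNonthreadObject Z := by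
  -- `dim C(X,-)` grows along nonzero maps between indecomposables of `C`, so the counting lemma
  -- applies in `Cᵒᵖ`, with the two kinds of almost split maps exchanged.
  have key : FinitelyManyUpToIso fun Z : Cᵒᵖ =>
      0 < Module.finrank k (X ⟶ Z.unop) ∧ IsNonthreadObject Z := by
    refine finitelyManyUpToIso_nonthread (d := fun Z : Cᵒᵖ => Module.finrank k (X ⟶ Z.unop))
      ?_ ?_ ?_ ?_ ?_ ?_ ?_ ?_ ?_ ?_
    · intro A B D e
      refine finrank_hom_to_add hfin X (i := (e.hom ≫ biprod.fst).unop)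
        (p := (biprod.inl ≫ e.inv).unop) (j := (e.hom ≫ biprod.snd).unop)
        (q := (biprod.inr ≫ e.inv).unop) ?_ ?_ ?_ ?_ ?_
      · exact Quiver.Hom.op_inj (by simp)
      · exact Quiver.Hom.op_inj (by simp)
      · exact Quiver.Hom.op_inj (by simp)
      · exact Quiver.Hom.op_inj (by simp)
      · refine Quiver.Hom.op_inj ?_
        rw [← cancel_epi e.inv, ← cancel_mono e.hom]
        simp
    · intro Y hY
      obtain ⟨A, hA, hAY⟩ := exists_indecomposable_retract hfin (X := Y.unop) fun h => hY h.op
      exact ⟨op A, indecomposable_op_iff.2 hA, nonempty_retract_op_iff.2 hAY⟩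
    · rintro A B ⟨ρ⟩
      have : IsSplitMono ρ.r.unop := ⟨⟨⟨ρ.i.unop, Quiver.Hom.op_inj ρ.retract⟩⟩⟩
      exact finrank_hom_to_le hfin X ρ.r.unop
    · intro E
      refine (finitelyManyUpToIso_retract hfin H E.unop).op.mono fun Z hZ => ?_
      exact ⟨indecomposable_op_iff.1 hZ.1, nonempty_retract_op_iff.1 hZ.2⟩
    · intro A B f hA hB hf
      have := H.mono_of_ne_zero (indecomposable_op_iff.1 hB) (f := f.unop)
        fun h => hf (Quiver.Hom.unop_inj h)
      exact finrank_hom_to_le hfin X f.unop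
    · intro A B hA hB f hf
      exact (isSplitMono_iff_isSplitEpi_of_indecomposable hA hB f).2 hf
    · intro Z hZ
      obtain ⟨L, l, he, hl⟩ := exists_isAlmostSplitFrom hfin H hl (indecomposable_op_iff.1 hZ)
      exact ⟨op L, l.op, inferInstance, (isAlmostSplitTo_op_iff l).2 hl⟩
    · intro Z hZ
      obtain ⟨R, r, hm, hr⟩ := exists_isAlmostSplitTo hfin H hr (indecomposable_op_iff.1 hZ)
      exact ⟨op R, r.op, inferInstance, (isAlmostSplitFrom_op_iff r).2 hr⟩
    · obtain ⟨E, hE⟩ := exists_finrank_eq_of_isAlmostSplitFrom hfin H hr hi X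
      refine ⟨op E, fun Z hZ R r hm hr => hE Z.unop ?_ R.unop r.unop inferInstance
        ((isAlmostSplitTo_op_iff _).1 hr)⟩
      rw [← not_nonempty_iff] at hZ ⊢
      exact fun h => hZ (nonempty_retract_op_iff.2 h)
    · refine ⟨op X, fun Z hZ L l he hl => finrank_eq_of_isAlmostSplitTo (Z := Z.unop) ?_
        (r := l.unop) inferInstance ((isAlmostSplitFrom_op_iff _).1 hl)⟩
      rw [← not_nonempty_iff] at hZ ⊢
      exact fun h => hZ (nonempty_retract_op_iff.2 h)
  exact key.unop.mono fun Z hZ => ⟨hZ.1, indecomposable_op_iff.2 hZ.2.1,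
    fun h => hZ.2.2 (isThreadObject_of_op h)⟩

end Dimensions

/-- The image is a first syzygy of the cokernel, whose projective dimension is at most one; so it is
projective and `P` maps onto it with a section. -/
theorem exists_split_image_of_projective {𝒜 : Type*} [Category 𝒜] [Abelian 𝒜]
    (hdim : ∀ M : 𝒜, HasProjectiveDimensionLE M 1) {P Q : 𝒜} [Projective Q] (f : P ⟶ Q) :
    ∃ (I : 𝒜) (e : P ⟶ I) (ι : I ⟶ Q) (s : I ⟶ P), s ≫ e = 𝟙 I ∧ Mono ι ∧ e ≫ ι = f := by
  have hses : (ShortComplex.mk (Abelian.image.ι f) (cokernel.π f)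
      (kernel.condition _)).ShortExact :=
    { exact := ShortComplex.exact_kernel _
      mono_f := inferInstance
      epi_g := inferInstance }
  have hproj : Projective (Abelian.image f) := by
    rw [projective_iff_hasProjectiveDimensionLT_one]
    exact (hses.hasProjectiveDimensionLT_X₃_iff 0 ‹_›).1 (hdim _)
  exact ⟨_, Abelian.factorThruImage f, Abelian.image.ι f,
    Projective.factorThru (𝟙 _) (Abelian.factorThruImage f), Projective.factorThru_comp _ _,
    inferInstance, Abelian.image.fac f⟩

/-! ### Finitely presented right modules and the consequences of heredity -/

section RightModules

variable {k : Type v} [Field k] {C : Type u} [Category.{v} C] [Preadditive C] [Linear k C]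

theorem linearYoneda_hom_apply {A Z : C} {M : Cᵒᵖ ⥤ ModuleCat.{v} k}
    (m : (linearYoneda k C).obj A ⟶ M) (f : Z ⟶ A) :
    (m.app (op Z)).hom f = (M.map f.op).hom ((m.app (op A)).hom (𝟙 A)) := by
  have h := congrArg (fun t => t.hom (𝟙 A)) (m.naturality f.op)
  refine Eq.trans ?_ h
  change (m.app (op Z)).hom f = (m.app (op Z)).hom (f ≫ 𝟙 A)
  rw [Category.comp_id]

theorem linearYoneda_hom_ext {A : C} {M : Cᵒᵖ ⥤ ModuleCat.{v} k}
    {m n : (linearYoneda k C).obj A ⟶ M}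
    (h : (m.app (op A)).hom (𝟙 A) = (n.app (op A)).hom (𝟙 A)) : m = n := by
  ext Z f
  exact (linearYoneda_hom_apply m (Z := Z.unop) f).trans <|
    (congrArg (M.map (Quiver.Hom.op f)).hom h).trans (linearYoneda_hom_apply n (Z := Z.unop) f).symm

theorem exists_linearYoneda_lift {A B : C} {M : Cᵒᵖ ⥤ ModuleCat.{v} k}
    {p : (linearYoneda k C).obj A ⟶ M} (hp : ∀ x, Function.Surjective (p.app x).hom)
    (m : (linearYoneda k C).obj B ⟶ M) : ∃ f : B ⟶ A, (linearYoneda k C).map f ≫ p = m := by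
  obtain ⟨f, hf⟩ := hp (op B) ((m.app (op B)).hom (𝟙 B))
  refine ⟨f, linearYoneda_hom_ext ?_⟩
  exact (congrArg (p.app (op B)).hom (Category.id_comp (X := B) (Y := A) f)).trans hf

/-- The form `φ` on `C(Y,W)` as a morphism from `C(-,W)` to `C(Y,-)*`. -/
def toStdInjective {W Y : C} (φ : Module.Dual k (Y ⟶ W)) :
    (linearYoneda k C).obj W ⟶ stdInjective k Y where
  app Z := ModuleCat.ofHom (X := Z.unop ⟶ W) (Y := Module.Dual k (Y ⟶ Z.unop))
    ((Linear.comp (S := k) Y Z.unop W).flip.compr₂ φ)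
  naturality Z Z' f := by
    ext h
    refine LinearMap.ext fun g => ?_
    exact congrArg φ (Category.assoc (W := Y) (Z := W) g f.unop h).symm

variable (k) in
theorem isFPRight_linearYoneda (A : C) :
    IsFPRight k C ((linearYoneda k C).obj A) := by
  refine ⟨A, A, 0, 𝟙 _, fun x => ⟨fun f => ⟨fun h => ⟨0, ?_⟩, ?_⟩, fun f => ⟨f, rfl⟩⟩⟩
  · rw [map_zero]; exact h.symm
  · rintro ⟨g, rfl⟩
    exact comp_zero

variable (k) in
/-- The embedding of `C` into finitely presented right modules. -/
abbrev rightYoneda (C : Type u) [Category.{v} C] [Preadditive C] [Linear k C] :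
    C ⥤ FPRight k C :=
  (IsFPRight k C).lift (linearYoneda k C) (isFPRight_linearYoneda k)

/-- The kernel of a morphism from a representable functor is generated by one element. -/
theorem exists_generator_kernel_right [HasEqualizers (FPRight k C)] {W : C}
    {M : Cᵒᵖ ⥤ ModuleCat.{v} k} (hM : IsFPRight k C M) (m : (linearYoneda k C).obj W ⟶ M) :
    ∃ (B : C) (u : B ⟶ W), (m.app (op B)).hom u = 0 ∧
      ∀ (Z : C) (h : Z ⟶ W), (m.app (op Z)).hom h = 0 → ∃ t : Z ⟶ B, t ≫ u = h := by
  -- The equalizer with the pointwise zero map replaces the kernel, so no abstract zero morphism has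
  -- to be compared with the pointwise one.
  let F : (rightYoneda k C).obj W ⟶ (⟨M, hM⟩ : FPRight k C) := ObjectProperty.homMk m
  let O : (rightYoneda k C).obj W ⟶ (⟨M, hM⟩ : FPRight k C) := ObjectProperty.homMk 0
  obtain ⟨B, B', f, p, hp⟩ := (equalizer F O).property
  obtain ⟨u, hu⟩ := (linearYoneda k C).map_surjective (p ≫ (equalizer.ι F O).hom)
  have hc : (equalizer.ι F O).hom ≫ m = 0 := by
    have := congrArg (fun t => t.hom) (equalizer.condition F O)
    exact this.trans comp_zero
  refine ⟨B, u, ?_, fun Z h hh => ?_⟩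
  · have h1 : (linearYoneda k C).map u ≫ m = 0 := by rw [hu, Category.assoc, hc, comp_zero]
    have h2 := congrArg (fun t => (t.app (op B)).hom (𝟙 B)) h1
    change (m.app (op B)).hom (𝟙 B ≫ u) = 0 at h2
    rwa [Category.id_comp] at h2
  · have h1 : (linearYoneda k C).map h ≫ m = 0 := linearYoneda_hom_ext (by
      change (m.app (op Z)).hom (𝟙 Z ≫ h) = 0
      rwa [Category.id_comp])
    have h2 : (rightYoneda k C).map h ≫ F = (rightYoneda k C).map h ≫ O := by
      ext1
      simpa [F, O] using h1
    obtain ⟨t, ht⟩ := exists_linearYoneda_lift (fun x => (hp x).2) (equalizer.lift _ h2).hom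
    refine ⟨t, (linearYoneda k C).map_injective ?_⟩
    rw [Functor.map_comp, hu, reassoc_of% ht]
    exact congrArg (fun t => t.hom) (equalizer.lift_ι _ h2)

/-- The pointwise cokernel is again finitely presented, so an epimorphism of the subcategory already
forces it to vanish. -/
theorem surjective_of_epi_FPRight [HasBinaryBiproducts C] {M N : FPRight k C} (e : M ⟶ N) [Epi e]
    (x : Cᵒᵖ) : Function.Surjective (e.hom.app x).hom := by
  obtain ⟨A, A', f, p, hp⟩ := M.property
  obtain ⟨B, B', g, q, hq⟩ := N.property
  obtain ⟨a, ha⟩ := exists_linearYoneda_lift (fun x => (hq x).2) (p ≫ e.hom)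
  have haq (x : Cᵒᵖ) (c : x.unop ⟶ A) :
      (q.app x).hom ((((linearYoneda k C).map a).app x).hom c) =
        (e.hom.app x).hom ((p.app x).hom c) :=
    congrArg (fun t => (t.app x).hom c) ha
  let π := cokernel.π e.hom
  have hπex (x : Cᵒᵖ) : Function.Exact (e.hom.app x).hom (π.app x).hom := by
    have h1 := (ShortComplex.exact_cokernel e.hom).map ((evaluation _ _).obj x)
    exact (ShortComplex.ShortExact.moduleCat_exact_iff_function_exact _).1 h1
  have hπs (x : Cᵒᵖ) : Function.Surjective (π.app x).hom := by
    rw [← ModuleCat.epi_iff_surjective]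
    infer_instance
  have hQ : IsFPRight k C (cokernel e.hom) := by
    -- The relations of the cokernel are those of `N` together with lifts of the images of the
    -- generators of `M`.
    refine ⟨B, B' ⊞ A, biprod.desc g a, q ≫ π, fun x => ⟨fun b => ⟨fun hb => ?_, ?_⟩, fun y => ?_⟩⟩
    · obtain ⟨m, hm⟩ := (hπex x _).1 hb
      obtain ⟨c, rfl⟩ := (hp x).2 m
      have hac : (q.app x).hom ((((linearYoneda k C).map a).app x).hom c) = (q.app x).hom b :=
        (haq x c).trans hm
      obtain ⟨d, hd⟩ := (hq x).1 (b - (((linearYoneda k C).map a).app x).hom c) |>.1 (by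
        rw [map_sub, hac, sub_self])
      exact ⟨biprod.lift (X := B') (Y := A) d c, (biprod.lift_desc (X := B') (Y := A)).trans
        (eq_sub_iff_add_eq.1 hd)⟩
    · rintro ⟨c, rfl⟩
      have hc (c : x.unop ⟶ B' ⊞ A) : c ≫ biprod.desc g a =
          (c ≫ biprod.fst) ≫ g + (c ≫ biprod.snd) ≫ a := by
        rw [biprod.desc_eq, Preadditive.comp_add, Category.assoc, Category.assoc]
      have h1 (d : x.unop ⟶ B') :
          (q.app x).hom ((((linearYoneda k C).map g).app x).hom d) = 0 :=
        (hq x).1.apply_apply_eq_zero d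
      have h2 (d : x.unop ⟶ A) :
          (π.app x).hom ((q.app x).hom ((((linearYoneda k C).map a).app x).hom d)) = 0 := by
        rw [haq x]
        exact (hπex x).apply_apply_eq_zero _
      refine ((congrArg (fun t => (π.app x).hom ((q.app x).hom t)) (hc c)).trans
        (congrArg (π.app x).hom (map_add (q.app x).hom _ _))).trans ?_
      refine (map_add (π.app x).hom _ _).trans ?_
      refine (congrArg₂ (· + ·) ((congrArg (π.app x).hom (h1 _)).trans (map_zero _))
        (h2 _)).trans ?_
      exact add_zero _
    · obtain ⟨n, rfl⟩ := hπs x y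
      obtain ⟨b, rfl⟩ := (hq x).2 n
      exact ⟨b, rfl⟩
  let Q : FPRight k C := ⟨_, hQ⟩
  have h0 : (ObjectProperty.homMk π : N ⟶ Q) = ObjectProperty.homMk 0 := by
    rw [← cancel_epi e]
    ext1
    change e.hom ≫ cokernel.π e.hom = e.hom ≫ 0
    simp
  have hπ0 : π = 0 := congrArg (fun t => t.hom) h0
  intro n
  refine (hπex x n).1 ?_
  rw [hπ0]
  rfl

instance projective_rightYoneda [HasBinaryBiproducts C] (A : C) :
    Projective ((rightYoneda k C).obj A) where
  factors {M N} m e _ := by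
    obtain ⟨x, hx⟩ := surjective_of_epi_FPRight e (op A) ((m.hom.app (op A)).hom (𝟙 A))
    obtain ⟨B, B', f, p, hp⟩ := M.property
    obtain ⟨a, ha⟩ := (hp (op A)).2 x
    refine ⟨ObjectProperty.homMk ((linearYoneda k C).map a ≫ p), ?_⟩
    ext1
    refine linearYoneda_hom_ext ?_
    refine Eq.trans ?_ hx
    rw [← ha]
    exact congrArg (fun t => (e.hom.app (op A)).hom ((p.app (op A)).hom t))
      (Category.id_comp (X := A) (Y := B) a)

theorem IsSemiHereditary.imagesSplitOff [HasBinaryBiproducts C]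
    [IsIdempotentComplete C] (h : IsSemiHereditary k C) : ImagesSplitOff C := by
  obtain ⟨inst, hdim⟩ := h
  intro A B f
  obtain ⟨I, e, ι, s, hs, hι, hf⟩ := exists_split_image_of_projective hdim
    ((rightYoneda k C).map f)
  -- The split projective image corresponds to an idempotent `q` of `A`; its splitting in `C` is the
  -- required image.
  obtain ⟨q, hq⟩ := (rightYoneda k C).map_surjective (e ≫ s)
  have hqq : q ≫ q = q := (rightYoneda k C).map_injective (by
    rw [Functor.map_comp, hq, Category.assoc, reassoc_of% hs])
  have hqf : q ≫ f = f := (rightYoneda k C).map_injective (by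
    rw [Functor.map_comp, hq, ← hf, Category.assoc, reassoc_of% hs])
  have hcancel {Z : C} (z z' : Z ⟶ A) (hz : z ≫ f = z' ≫ f) : z ≫ q = z' ≫ q :=
    (rightYoneda k C).map_injective (by
      have h1 := congrArg (rightYoneda k C).map hz
      rw [Functor.map_comp, Functor.map_comp, ← hf, ← Category.assoc, ← Category.assoc,
        cancel_mono] at h1
      rw [Functor.map_comp, Functor.map_comp, hq, reassoc_of% h1])
  obtain ⟨A', j, p, hjp, hpj⟩ := IsIdempotentComplete.idempotents_split A q hqq
  refine ⟨A', p, j ≫ f, ⟨⟨⟨j, hjp⟩⟩⟩, ⟨fun {Z} z z' hz => ?_⟩, ?_⟩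
  · have h1 := congrArg (fun t => t ≫ p) (hcancel (z ≫ j) (z' ≫ j) (by simpa using hz))
    simpa [← hpj, hjp, reassoc_of% hjp] using h1
  · rw [← Category.assoc, hpj, hqf]

end RightModules

/-! ### Finitely presented left modules -/

section LeftModules

variable {k : Type v} [Field k] {C : Type u} [Category.{v} C] [Preadditive C] [Linear k C]

theorem linearCoyoneda_hom_apply {A Z : C} {M : C ⥤ ModuleCat.{v} k}
    (m : (linearCoyoneda k C).obj (op A) ⟶ M) (f : A ⟶ Z) :
    (m.app Z).hom f = (M.map f).hom ((m.app A).hom (𝟙 A)) := by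
  have h := congrArg (fun t => t.hom (𝟙 A)) (m.naturality f)
  refine Eq.trans ?_ h
  change (m.app Z).hom f = (m.app Z).hom (𝟙 A ≫ f)
  rw [Category.id_comp]

theorem linearCoyoneda_hom_ext {A : C} {M : C ⥤ ModuleCat.{v} k}
    {m n : (linearCoyoneda k C).obj (op A) ⟶ M}
    (h : (m.app A).hom (𝟙 A) = (n.app A).hom (𝟙 A)) : m = n := by
  ext Z f
  exact (linearCoyoneda_hom_apply m (Z := Z) f).trans <|
    (congrArg (M.map f).hom h).trans (linearCoyoneda_hom_apply n (Z := Z) f).symm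

theorem exists_linearCoyoneda_lift {A B : C} {M : C ⥤ ModuleCat.{v} k}
    {p : (linearCoyoneda k C).obj (op A) ⟶ M} (hp : ∀ x, Function.Surjective (p.app x).hom)
    (m : (linearCoyoneda k C).obj (op B) ⟶ M) :
    ∃ f : A ⟶ B, (linearCoyoneda k C).map f.op ≫ p = m := by
  obtain ⟨f, hf⟩ := hp B ((m.app B).hom (𝟙 B))
  refine ⟨f, linearCoyoneda_hom_ext ?_⟩
  exact (congrArg (p.app B).hom (Category.comp_id (X := A) (Y := B) f)).trans hf

/-- The form `φ` on `C(W,Y)` as a morphism from `C(W,-)` to `C(-,Y)*`. -/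
def toDualProjective {W Y : C} (φ : Module.Dual k (W ⟶ Y)) :
    (linearCoyoneda k C).obj (op W) ⟶ (dualFunctor k C).obj (op (stdProjective k Y)) where
  app Z := ModuleCat.ofHom (X := W ⟶ Z) (Y := Module.Dual k (Z ⟶ Y))
    ((Linear.comp (S := k) W Z Y).compr₂ φ)
  naturality Z Z' f := by
    ext h
    refine LinearMap.ext fun g => ?_
    exact congrArg φ (Category.assoc (W := W) (Z := Y) h f g)

variable (k) in
theorem isFPLeft_linearCoyoneda (A : Cᵒᵖ) : IsFPLeft k C ((linearCoyoneda k C).obj A) := by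
  refine ⟨A.unop, A.unop, 0, 𝟙 _, fun x => ⟨fun f => ⟨fun h => ⟨0, ?_⟩, ?_⟩, fun f => ⟨f, rfl⟩⟩⟩
  · rw [map_zero]; exact h.symm
  · rintro ⟨g, rfl⟩
    exact zero_comp

variable (k) in
/-- The embedding of the opposite category of `C` into finitely presented left modules. -/
abbrev leftYoneda (C : Type u) [Category.{v} C] [Preadditive C] [Linear k C] :
    Cᵒᵖ ⥤ FPLeft k C :=
  (IsFPLeft k C).lift (linearCoyoneda k C) (isFPLeft_linearCoyoneda k)

/-- The kernel of a morphism from a corepresentable functor is generated by one element. -/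
theorem exists_generator_kernel_left [HasEqualizers (FPLeft k C)] {W : C}
    {M : C ⥤ ModuleCat.{v} k} (hM : IsFPLeft k C M)
    (m : (linearCoyoneda k C).obj (op W) ⟶ M) :
    ∃ (B : C) (u : W ⟶ B), (m.app B).hom u = 0 ∧
      ∀ (Z : C) (h : W ⟶ Z), (m.app Z).hom h = 0 → ∃ t : B ⟶ Z, u ≫ t = h := by
  let F : (leftYoneda k C).obj (op W) ⟶ (⟨M, hM⟩ : FPLeft k C) := ObjectProperty.homMk m
  let O : (leftYoneda k C).obj (op W) ⟶ (⟨M, hM⟩ : FPLeft k C) := ObjectProperty.homMk 0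
  obtain ⟨B, B', f, p, hp⟩ := (equalizer F O).property
  obtain ⟨u, hu⟩ := (linearCoyoneda k C).map_surjective (p ≫ (equalizer.ι F O).hom)
  have hc : (equalizer.ι F O).hom ≫ m = 0 := by
    have := congrArg (fun t => t.hom) (equalizer.condition F O)
    exact this.trans comp_zero
  refine ⟨B, u.unop, ?_, fun Z h hh => ?_⟩
  · have h1 : (linearCoyoneda k C).map u ≫ m = 0 := by rw [hu, Category.assoc, hc, comp_zero]
    have h2 := congrArg (fun t => (t.app B).hom (𝟙 B)) h1
    change (m.app B).hom (u.unop ≫ 𝟙 B) = 0 at h2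
    rwa [Category.comp_id] at h2
  · have h1 : (linearCoyoneda k C).map h.op ≫ m = 0 := linearCoyoneda_hom_ext (by
      change (m.app Z).hom (h ≫ 𝟙 Z) = 0
      rwa [Category.comp_id])
    have h2 : (leftYoneda k C).map h.op ≫ F = (leftYoneda k C).map h.op ≫ O := by
      ext1
      simpa [F, O] using h1
    obtain ⟨t, ht⟩ := exists_linearCoyoneda_lift (fun x => (hp x).2) (equalizer.lift _ h2).hom
    refine ⟨t, Quiver.Hom.op_inj ((linearCoyoneda k C).map_injective ?_)⟩
    rw [op_comp, Quiver.Hom.op_unop, Functor.map_comp, hu, reassoc_of% ht]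
    exact congrArg (fun t => t.hom) (equalizer.lift_ι _ h2)

end LeftModules

/-! ### Consequences of the duality -/

section Dualizing

variable {k : Type v} [Field k] {C : Type u} [Category.{v} C] [Preadditive C] [Linear k C]

theorem IsDualizing.isFPLeft_dualProjective (h : IsDualizing k C) (X : C) :
    IsFPLeft k C ((dualFunctor k C).obj (op (stdProjective k X))) :=
  h.choose (op ((rightYoneda k C).obj X))

theorem IsDualizing.dualProjectivesFG (h : IsDualizing k C) : DualProjectivesFG k C := by
  intro X
  obtain ⟨A, B, f, p, hp⟩ := h.isFPLeft_dualProjective X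
  refine ⟨A, (p.app A).hom (𝟙 A), fun Z ψ => ?_⟩
  obtain ⟨a, ha⟩ := (hp Z).2 ψ
  refine ⟨a, fun g => ?_⟩
  rw [← ha]
  exact (congrArg (fun t : Module.Dual k (Z ⟶ X) => t g)
    (linearCoyoneda_hom_apply p (Z := Z) a)).symm

theorem IsDualizing.leftAnnihilatorsFG (h : IsDualizing k C) (hsh : IsSemiHereditary k C) :
    LeftAnnihilatorsFG k C := by
  obtain ⟨inst, -⟩ := hsh
  -- Left modules are equivalent to the opposite of the abelian category of right modules, which has
  -- all equalizers.
  have : HasEqualizers (FPLeft k C) := by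
    have := h.choose_spec
    exact Adjunction.hasLimitsOfShape_of_equivalence
      ((IsFPLeft k C).lift ((IsFPRight k C).ι.op ⋙ dualFunctor k C) h.choose).inv
  intro W Y φ
  obtain ⟨B, u, hu, huniv⟩ := exists_generator_kernel_left (h.isFPLeft_dualProjective Y)
    (toDualProjective φ)
  exact ⟨B, u, fun g => congrArg (fun t : Module.Dual k (B ⟶ Y) => t g) hu,
    fun Z t ht => huniv Z t (LinearMap.ext fun g => ht g)⟩

/-- Essential surjectivity gives a finitely presented `M` with `C(X,-) ≅ D(M)`. Its values are
finite-dimensional, so `M` is its own double dual, and a presentation of `M` presents `C(X,-)*`. -/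
theorem IsDualizing.isFPRight_stdInjective (h : IsDualizing k C) (hfin : HomFinite k C) (X : C) :
    IsFPRight k C (stdInjective k X) := by
  obtain ⟨h, heq⟩ := h
  let D := (IsFPLeft k C).lift ((IsFPRight k C).ι.op ⋙ dualFunctor k C) h
  let M := D.objPreimage ((leftYoneda k C).obj (op X))
  let e := D.objObjPreimageIso ((leftYoneda k C).obj (op X))
  obtain ⟨A, B, f, p, hp⟩ := M.unop.property
  let θ (Z : C) : (X ⟶ Z) ≃ₗ[k] Module.Dual k (M.unop.obj.obj (op Z)) :=
    (((IsFPLeft k C).ι.mapIso e.symm).app Z).toLinearEquiv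
  have hθ {Z Z' : C} (g : X ⟶ Z) (a : Z ⟶ Z') (m : M.unop.obj.obj (op Z')) :
      θ Z' (g ≫ a) m = θ Z g ((M.unop.obj.map a.op).hom m) :=
    congrArg (fun t => (show Module.Dual k (M.unop.obj.obj (op Z')) from t.hom g) m)
      (e.inv.hom.naturality a)
  let φ : Module.Dual k (X ⟶ A) :=
    (Module.Dual.eval k _ ((p.app (op A)).hom (𝟙 A))).comp (θ A).toLinearMap
  have hφ {Z : C} (g : X ⟶ Z) (a : Z ⟶ A) : φ (g ≫ a) = θ Z g ((p.app (op Z)).hom a) :=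
    (hθ g a _).trans (congrArg (θ Z g) (linearYoneda_hom_apply p a).symm)
  refine ⟨A, B, f, toStdInjective φ, fun x => ⟨fun a => Iff.trans ?_ ((hp x).1 a), fun ψ => ?_⟩⟩
  · refine Iff.trans ?_ (Module.forall_dual_apply_eq_zero_iff k ((p.app x).hom a))
    refine ⟨fun ha ψ => ?_, fun ha => LinearMap.ext fun g => ?_⟩
    · obtain ⟨g, rfl⟩ := (θ x.unop).surjective ψ
      exact (hφ g a).symm.trans (congrArg (fun t : Module.Dual k (X ⟶ x.unop) => t g) ha)
    · exact (hφ g a).trans (ha _)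
  · have : Module.Finite k (((linearYoneda k C).obj A).obj x) := hfin x.unop A
    have : Module.Finite k (M.unop.obj.obj x) :=
      Module.Finite.of_surjective (p.app x).hom (hp x).2
    obtain ⟨m, hm⟩ := (Module.bijective_dual_eval k (M.unop.obj.obj x)).2
      ((show Module.Dual k (X ⟶ x.unop) from ψ).comp (θ x.unop).symm.toLinearMap)
    obtain ⟨a, rfl⟩ := (hp x).2 m
    refine ⟨a, LinearMap.ext fun g => (hφ g a).trans ?_⟩
    exact (DFunLike.congr_fun hm (θ x.unop g)).trans
      (congrArg (show Module.Dual k (X ⟶ x.unop) from ψ) ((θ x.unop).symm_apply_apply g))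

theorem IsDualizing.injectivesFG (h : IsDualizing k C) (hfin : HomFinite k C) :
    InjectivesFG k C := by
  intro X
  obtain ⟨A, B, f, p, hp⟩ := h.isFPRight_stdInjective hfin X
  refine ⟨A, (p.app (op A)).hom (𝟙 A), fun Z ψ => ?_⟩
  obtain ⟨a, ha⟩ := (hp (op Z)).2 ψ
  refine ⟨a, fun g => ?_⟩
  rw [← ha]
  exact (congrArg (fun t : Module.Dual k (X ⟶ Z) => t g)
    (linearYoneda_hom_apply p (Z := Z) a)).symm

theorem IsDualizing.rightAnnihilatorsFG (h : IsDualizing k C) (hsh : IsSemiHereditary k C)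
    (hfin : HomFinite k C) : RightAnnihilatorsFG k C := by
  obtain ⟨inst, -⟩ := hsh
  intro W Y φ
  obtain ⟨B, u, hu, huniv⟩ := exists_generator_kernel_right (h.isFPRight_stdInjective hfin Y)
    (toStdInjective φ)
  exact ⟨B, u, fun g => congrArg (fun t : Module.Dual k (Y ⟶ B) => t g) hu,
    fun Z t ht => huniv Z t (LinearMap.ext fun g => ht g)⟩

end Dualizing

end ThreadCat

end

theorem mainTheorem7 (k : Type v) [Field k] [IsAlgClosed k]
    (C : Type u) [Category.{v} C] [Preadditive C] [Linear k C]
    [HasZeroObject C] [HasBinaryBiproducts C] [IsIdempotentComplete C]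
    (hfin : ThreadCat.HomFinite k C)
    (hdual : ThreadCat.IsDualizing k C)
    (hsh : ThreadCat.IsSemiHereditary k C) :
    (∀ X : C, Indecomposable X →
      ThreadCat.FinitelyManyUpToIso (fun Z : C =>
        ThreadCat.supp (ThreadCat.stdInjective k X) Z ∧ ThreadCat.IsNonthreadObject Z) ∧
      ThreadCat.FinitelyManyUpToIso (fun Z : C =>
        ThreadCat.supp (ThreadCat.stdProjective k X) Z ∧ ThreadCat.IsNonthreadObject Z)) ∧
    (∀ X Y : C, Indecomposable X → Indecomposable Y → ThreadCat.IsThread X Y →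
      (∃ W : C, Indecomposable W ∧ ThreadCat.interval X Y W) →
      Module.finrank k (X ⟶ Y) = 1) ∧
    (∀ X Y Z : C, Indecomposable X → Indecomposable Y → Indecomposable Z →
      ThreadCat.IsThread X Y → ThreadCat.IsThread X Z →
      ThreadCat.interval X Y ≤ ThreadCat.interval X Z ∨
        ThreadCat.interval X Z ≤ ThreadCat.interval X Y) := by
  have H := hsh.imagesSplitOff
  have hl := hdual.leftAnnihilatorsFG hsh
  have hr := hdual.rightAnnihilatorsFG hsh hfin
  refine ⟨fun X _ => ⟨?_, ?_⟩, fun X Y hX hY hXY hne =>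
    ThreadCat.finrank_eq_one_of_isThread hfin H hl hX hY hXY hne, fun X Y Z hX hY hZ hXY _ =>
    ThreadCat.interval_le_or_le_of_isThread hfin H hl hX hY hZ hXY⟩
  · refine (ThreadCat.finitelyManyUpToIso_nonthread_hom_from hfin H hl hr
      (hdual.injectivesFG hfin) X).mono fun Z ⟨hZ, hn⟩ => ⟨?_, hn⟩
    have hnt : Nontrivial (Module.Dual k (X ⟶ Z)) := hZ Z hn.1 ⟨Retract.refl Z⟩
    have := hfin X Z
    have := (Module.nontrivial_dual_iff k).1 hnt
    exact Module.finrank_pos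
  · refine (ThreadCat.finitelyManyUpToIso_nonthread_hom_to hfin H hl hr
      hdual.dualProjectivesFG X).mono fun Z ⟨hZ, hn⟩ => ⟨?_, hn⟩
    have : Nontrivial (Z ⟶ X) := hZ Z hn.1 ⟨Retract.refl Z⟩
    have := hfin Z X
    exact Module.finrank_pos
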